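/- Let $d\ge 1$ be an integer. For $\lambda\in\mathbb R\cup i(-\tfrac d2,\tfrac d2)$ and $\sigma\in\mathbb C\setminus[1,\infty)$ let $$G^{(d)}_\lambda(\sigma)=\frac{\Gamma(\frac d2+i\lambda)\Gamma(\frac d2-i\lambda)}{(4\pi)^{\frac{d+1}2}\,\Gamma(\frac{d+1}2)}\;{}_2F_1\Big(\tfrac d2+i\lambda,\tfrac d2-i\lambda;\tfrac{d+1}2;\tfrac{1+\sigma}2\Big)$$ be the free propagator, where ${}_2F_1$ is analytically continued to $\mathbb C\setminus[1,\infty)$. The radial variable $\rho$ is defined by $\rho=\frac{1-\sqrt{1-z}}{1+\sqrt{1-z}}$ with $z=\frac{1+\sigma}2$; equivalently $\frac{1+\sigma}2=\frac{4\rho}{(1+\rho)^2}$, $|\rho|<1$. Let $$B_n(d,\lambda)=\frac{\Gamma(\frac d2+i\lambda)\Gamma(\frac d2-i\lambda)}{(4\pi)^{\frac{d+1}2}\Gamma(\frac{d+1}2)}\,b_n(d,\lambda),$$ $$b_n(d,\lambda)=\sum_{l=0}^{\min(d,n)}\sum_{k=0}^{n-l}\binom dl\frac{(\frac{d-1}2)_k\,(n-l-k)!}{k!\,(\frac{d+1}2)_{n-l-k}}\prod_{\pm}a_{n-l-k}\Big(\tfrac{d+1}4,-\tfrac{d-1}4\pm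 i\lambda\Big),$$ $$a_n(h,\delta)=\sum_{k=0}^n\frac{(-1)^k(h-\delta)_k(h+\delta)_{n-k}}{k!\,(n-k)!}.$$ Let $G_{\mathcal O}$ be a function of pairs of points of the unit sphere $S^{d+1}\subset\mathbb R^{d+2}$ (a scalar two-point function). Assume that there are nonnegative spectral densities $\varrho^{\mathcal P}$ on $\mathbb R$ and $\varrho^{\mathcal C}$ on $(-\frac d2,\frac d2)$ (understood as positive measures $\varrho(\lambda)\,d\lambda$, so that delta functions are allowed) such that for all $Y_1\ne Y_2$ in $S^{d+1}$, with $\sigma=Y_1\cdot Y_2$, $$G_{\mathcal O}(Y_1,Y_2)=\int_{\mathbb R}d\lambda\,\varrho^{\mathcal P}(\lambda)\,G^{(d)}_\lambda(\sigma)+\int_{-d/2}^{d/2}d\lambda\,\varrho^{\mathcal C}(\lambda)\,G^{(d)}_{i\lambda}(\sigma),$$ where both integrals converge. Then for every $n\ge 0$ the integrals in $$c_n=\int_{\mathbb R}d\lambda\,\varrho^{\mathcal P}(\lambda)\,B_n(d,\lambda)+\int_{-d/2}^{d/2}d\lambda\,\varrho^{\mathcal C}(\lambda)\,B_n(d,i\lambda)$$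 converge and $c_n$ is real and nonnegative; for all $Y_1\neq Y_2$ in $S^{d+1}$ the radial variable $\rho$ of $\sigma=Y_1\cdot Y_2$ satisfies $|\rho|<1$ and $$G_{\mathcal O}(Y_1,Y_2)=\sum_{n=0}^\infty c_n\rho^n;$$ and for every complex $\rho$ with $|\rho|<1$ the series $\sum_n c_n\rho^n$ converges absolutely, both integrals of the above representation converge absolutely at $\sigma=\frac{8\rho}{(1+\rho)^2}-1$, and their sum, which extends $G_{\mathcal O}$ to the open unit disc of $\rho$, equals $\sum_{n=0}^\infty c_n\rho^n$. -/

import Mathlib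

open MeasureTheory

noncomputable section

namespace DeSitter

/-- The cut plane `ℂ \ [1, ∞)`. -/
def cutPlane : Set ℂ := {z | 1 - z ∈ Complex.slitPlane}

/-- `F` is an analytic continuation to the cut plane of the regularized hypergeometric series
`∑ (a)ₙ (b)ₙ zⁿ / (Γ(c + n) n!)`. -/
def IsHypergeometricContinuation (a b c : ℂ) (F : ℂ → ℂ) : Prop :=
  AnalyticOnNhd ℂ F cutPlane ∧
    ∀ z : ℂ, ‖z‖ < 1 → F z = Complex.regularizedGaussHGFun a b c z

open Classical in
/-- The regularized hypergeometric function `𝐅(a, b; c; z) = ₂F₁(a, b; c; z) / Γ(c)` on the cut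
plane: the (unique) analytic continuation of the hypergeometric series. -/
def hypergeometricF (a b c : ℂ) : ℂ → ℂ :=
  if h : ∃ F : ℂ → ℂ, IsHypergeometricContinuation a b c F then h.choose
  else Complex.regularizedGaussHGFun a b c

/-- The continuation is unique on the cut plane, so the choice in the definition is harmless. -/
theorem hypergeometricF_eqOn {a b c : ℂ} {F : ℂ → ℂ}
    (hF : IsHypergeometricContinuation a b c F) :
    Set.EqOn (hypergeometricF a b c) F cutPlane := by
  have h : ∃ F : ℂ → ℂ, IsHypergeometricContinuation a b c F := ⟨F, hF⟩
  have hc := h.choose_spec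
  have hdef : hypergeometricF a b c = h.choose := by
    unfold hypergeometricF
    rw [dif_pos h]
  rw [hdef]
  have hconn : IsPreconnected cutPlane := by
    have h1 : cutPlane = (fun z : ℂ => 1 - z) '' Complex.slitPlane := by
      ext z
      constructor
      · intro hz
        exact ⟨1 - z, hz, by simp⟩
      · rintro ⟨w, hw, rfl⟩
        simpa [cutPlane] using hw
    rw [h1]
    exact (Complex.starConvex_one_slitPlane.isPathConnected (by simp)).isConnected.isPreconnected.image _
      (by fun_prop)
  refine hc.1.eqOn_of_preconnected_of_eventuallyEq hF.1 hconn (z₀ := 0) (by simp [cutPlane]) ?_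
  filter_upwards [Metric.ball_mem_nhds (0 : ℂ) one_pos] with z hz
  have hz' : ‖z‖ < 1 := by simpa using hz
  rw [hc.2 z hz', hF.2 z hz']

/-- The free propagator `G_λ^{(d)}(σ)` of a scalar of mass `m² = d²/4 + λ²` in the Bunch-Davies
vacuum, with unit de Sitter radius. -/
def freePropagator (d : ℕ) (lam σ : ℂ) : ℂ :=
  Complex.Gamma ((d : ℂ) / 2 + Complex.I * lam) * Complex.Gamma ((d : ℂ) / 2 - Complex.I * lam) /
      (((4 * Real.pi) ^ (((d : ℝ) + 1) / 2) : ℝ) : ℂ) *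
    hypergeometricF ((d : ℂ) / 2 + Complex.I * lam) ((d : ℂ) / 2 - Complex.I * lam)
      (((d : ℂ) + 1) / 2) ((1 + σ) / 2)

/-- The Pochhammer symbol `(x)ₙ`. -/
def poch (x : ℂ) (n : ℕ) : ℂ := (ascPochhammer ℂ n).eval x

/-- `aₙ(h, δ) = ∑_{k=0}^n (-1)^k (h-δ)_k (h+δ)_{n-k} / (k! (n-k)!)`. -/
def aCoeff (n : ℕ) (h δ : ℂ) : ℂ :=
  ∑ k ∈ Finset.range (n + 1),
    (-1) ^ k * poch (h - δ) k * poch (h + δ) (n - k) / ((k.factorial : ℂ) * ((n - k).factorial : ℂ))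

/-- The coefficients `bₙ(d, λ)`; the inner sum runs over `0 ≤ k ≤ n - l` and is empty if `l > n`. -/
def bCoeff (d n : ℕ) (lam : ℂ) : ℂ :=
  ∑ l ∈ Finset.range (d + 1), ∑ k ∈ Finset.range (n + 1 - l),
    (d.choose l : ℂ) *
      (poch (((d : ℂ) - 1) / 2) k * ((n - l - k).factorial : ℂ) /
        ((k.factorial : ℂ) * poch (((d : ℂ) + 1) / 2) (n - l - k))) *
      (aCoeff (n - l - k) (((d : ℂ) + 1) / 4) (-(((d : ℂ) - 1) / 4) + Complex.I * lam) *
        aCoeff (n - l - k) (((d : ℂ) + 1) / 4) (-(((d : ℂ) - 1) / 4) - Complex.I * lam))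

/-- The coefficients `Bₙ(d, λ) = Γ(d/2 ± iλ) / ((4π)^{(d+1)/2} Γ((d+1)/2)) · bₙ(d, λ)`. -/
def BCoeff (d n : ℕ) (lam : ℂ) : ℂ :=
  Complex.Gamma ((d : ℂ) / 2 + Complex.I * lam) * Complex.Gamma ((d : ℂ) / 2 - Complex.I * lam) /
      ((((4 * Real.pi) ^ (((d : ℝ) + 1) / 2) : ℝ) : ℂ) * Complex.Gamma (((d : ℂ) + 1) / 2)) *
    bCoeff d n lam

/-- The interval `(-d/2, d/2)` that parametrizes the complementary series. -/
def complementaryRange (d : ℕ) : Set ℝ := Set.Ioo (-((d : ℝ) / 2)) ((d : ℝ) / 2)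

/-- (Absolute) convergence of the spectral integral of `f`: here `f` is evaluated at `λ ∈ ℝ`
against the principal spectral measure `μP` and at `iλ`, `λ ∈ (-d/2, d/2)`, against the
complementary one `μC`. -/
def SpectralConverges (d : ℕ) (μP μC : Measure ℝ) (f : ℂ → ℂ) : Prop :=
  Integrable (fun lam : ℝ => f (lam : ℂ)) μP ∧
    IntegrableOn (fun lam : ℝ => f (Complex.I * (lam : ℂ))) (complementaryRange d) μC

/-- The spectral integral `∫_ℝ dμP(λ) f(λ) + ∫_{(-d/2, d/2)} dμC(λ) f(iλ)`.  Spectral densities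
are positive measures `dμ = ϱ(λ) dλ`: a nonnegative function `ϱ` is the measure
`volume.withDensity (fun l => ENNReal.ofReal (ϱ l))`, and delta functions are allowed. -/
def spectralIntegral (d : ℕ) (μP μC : Measure ℝ) (f : ℂ → ℂ) : ℂ :=
  (∫ lam : ℝ, f (lam : ℂ) ∂μP) +
    (∫ lam in complementaryRange d, f (Complex.I * (lam : ℂ)) ∂μC)

/-- The unit sphere `S^{d+1}` in `ℝ^{d+2}`. -/
abbrev Sphere (d : ℕ) : Type := Metric.sphere (0 : EuclideanSpace ℝ (Fin (d + 2))) 1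

/-- The two-point invariant `σ = Y₁ · Y₂` on the sphere. -/
def sphereSigma {d : ℕ} (Y₁ Y₂ : Sphere d) : ℝ :=
  inner ℝ (Y₁ : EuclideanSpace ℝ (Fin (d + 2))) (Y₂ : EuclideanSpace ℝ (Fin (d + 2)))

/-- The two-point function `G` on `S^{d+1}` has, at all pairs of non-coincident points, a
convergent Källén–Lehmann representation over the principal and complementary series with the
positive spectral measures `μP` and `μC`. -/
def HasKallenLehmann (d : ℕ) (μP μC : Measure ℝ) (G : Sphere d → Sphere d → ℂ) : Prop :=
  ∀ Y₁ Y₂ : Sphere d, Y₁ ≠ Y₂ →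
    SpectralConverges d μP μC (fun lam => freePropagator d lam (sphereSigma Y₁ Y₂ : ℂ)) ∧
    G Y₁ Y₂ = spectralIntegral d μP μC (fun lam => freePropagator d lam (sphereSigma Y₁ Y₂ : ℂ))

/-- The radial variable `ρ = (1 - √(1-z)) / (1 + √(1-z))` with `z = (1+σ)/2` (principal root). -/
def radial (σ : ℂ) : ℂ :=
  (1 - (1 - (1 + σ) / 2) ^ (1 / 2 : ℂ)) / (1 + (1 - (1 + σ) / 2) ^ (1 / 2 : ℂ))

/-- The inverse change of variables: `(1+σ)/2 = 4ρ/(1+ρ)²`. -/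
def sigmaOfRadial (ρ : ℂ) : ℂ := 8 * ρ / (1 + ρ) ^ 2 - 1

end DeSitter

end

/-!
The parameters `a, b = d/2 ± iλ` and `c = (d+1)/2` satisfy `a + b + 1 = 2c`, so `z = 4ρ/(1+ρ)²` is
a quadratic change of variables for the Gauss equation. In `ρ` the equation has at the origin a
unique normalized power series solution, namely `(1-ρ)^(1-c) (1+ρ)^(2c-1) ∑ₘ m!/(c)ₘ Aₘ Bₘ ρᵐ`,
where `Aₘ` and `Bₘ` are the Taylor coefficients of `(1-ρ)^(a-c) (1+ρ)^(-a)` and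
`(1-ρ)^(b-c) (1+ρ)^(-b)`. Expanding the product shows that its coefficients are the `bₙ(d, λ)`.

For the principal series `Aₘ Bₘ = |Aₘ|²`, and the prefactor has nonnegative coefficients, hence
`bₙ ≥ 0`. For the complementary series `a` and `b` are positive. If neither is much larger than the
other, the derivative of the solution is a product of the same kind in which all factors are
nonnegative; otherwise a contiguity relation lowers the larger parameter by `2` and `c` by `1`.
The induction starts at `c = 1`, covered by the first case, and at `c = 3/2`, where the series is
elementary.

Since `Bₙ ≥ 0`, the propagator at `|ρ|` dominates its `ρ`-expansion at `ρ`. Every value of `|ρ|` in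
`[0, 1)` is the radial variable of two distinct points of the sphere, where the representation
converges by assumption, so dominated convergence exchanges the sum and the spectral integrals on
the whole disc.
-/

noncomputable section

namespace DeSitter

open PowerSeries
open scoped Topology

section IntCoeff

variable {R : Type*} [CommRing R]

/-- The `n`-th coefficient of a power series for an integer `n`, zero for `n < 0`. With this
convention multiplication by `X` is a shift of the index, without boundary cases. -/
def intCoeff (n : ℤ) : R⟦X⟧ →ₗ[R] R := if 0 ≤ n then coeff n.toNat else 0

theorem intCoeff_natCast (n : ℕ) (f : R⟦X⟧) : intCoeff n f = coeff n f := by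
  simp [intCoeff]

theorem intCoeff_of_neg {n : ℤ} (hn : n < 0) (f : R⟦X⟧) : intCoeff n f = 0 := by
  simp [intCoeff, hn.not_ge]

theorem intCoeff_zero (f : R⟦X⟧) : intCoeff 0 f = constantCoeff f := by
  rw [← Nat.cast_zero, intCoeff_natCast, coeff_zero_eq_constantCoeff_apply]

theorem ext_intCoeff {f g : R⟦X⟧} (h : ∀ n, intCoeff n f = intCoeff n g) : f = g :=
  PowerSeries.ext fun n => by simpa only [intCoeff_natCast] using h n

theorem intCoeff_C_mul (n : ℤ) (r : R) (f : R⟦X⟧) : intCoeff n (C r * f) = r * intCoeff n f := by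
  rw [← smul_eq_C_mul, map_smul, smul_eq_mul]

theorem intCoeff_X_mul (n : ℤ) (f : R⟦X⟧) : intCoeff n (X * f) = intCoeff (n - 1) f := by
  rcases lt_trichotomy n 0 with hn | rfl | hn
  · rw [intCoeff_of_neg hn, intCoeff_of_neg (by lia)]
  · rw [intCoeff_of_neg (by lia : (0 : ℤ) - 1 < 0), ← Nat.cast_zero, intCoeff_natCast,
      coeff_zero_X_mul]
  · obtain ⟨m, rfl⟩ : ∃ m : ℕ, n = (m + 1 : ℕ) := ⟨n.toNat - 1, by lia⟩
    rw [intCoeff_natCast, coeff_succ_X_mul, ← intCoeff_natCast]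
    push_cast
    rw [add_sub_cancel_right]

theorem intCoeff_X_pow_mul (n : ℤ) (k : ℕ) (f : R⟦X⟧) :
    intCoeff n (X ^ k * f) = intCoeff (n - k) f := by
  induction k generalizing n with
  | zero => simp
  | succ k ih => rw [pow_succ', mul_assoc, intCoeff_X_mul, ih, Nat.cast_succ, sub_sub, add_comm 1]

theorem intCoeff_derivative (n : ℤ) (f : R⟦X⟧) :
    intCoeff n (d⁄dX R f) = (n + 1) * intCoeff (n + 1) f := by
  rcases lt_trichotomy n (-1) with hn | rfl | hn
  · rw [intCoeff_of_neg (by lia), intCoeff_of_neg (by lia), mul_zero]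
  · simp [intCoeff_of_neg]
  · obtain ⟨m, rfl⟩ : ∃ m : ℕ, n = m := ⟨n.toNat, by lia⟩
    rw [intCoeff_natCast, coeff_derivative, ← intCoeff_natCast, mul_comm]
    push_cast
    rfl

theorem derivative_rescale (r : R) (f : R⟦X⟧) :
    d⁄dX R (rescale r f) = C r * rescale r (d⁄dX R f) := by
  ext n
  simp only [coeff_derivative, coeff_rescale, coeff_C_mul]
  ring

theorem rescale_C (r s : R) : rescale r (C s) = C s := by
  ext n
  rw [coeff_rescale, coeff_C]
  split_ifs with hn <;> simp [hn]

end IntCoeff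

section FormalSeries

variable {K : Type*} [Field K] [CharZero K]

theorem factorial_mul_choose (r : K) (n : ℕ) :
    (n.factorial : K) * Ring.choose r n = (descPochhammer K n).eval r := by
  rw [← nsmul_eq_mul, ← Ring.descPochhammer_eq_factorial_smul_choose,
    ← descPochhammer_map (Int.castRingHom K), Polynomial.eval_map,
    ← Polynomial.eval₂_smulOneHom_eq_smeval ℤ]
  congr 1
  exact Subsingleton.elim _ _

theorem succ_mul_choose_succ (r : K) (n : ℕ) :
    (n + 1) * Ring.choose r (n + 1) = (r - n) * Ring.choose r n := by
  have hn : (n.factorial : K) ≠ 0 := by exact_mod_cast n.factorial_ne_zero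
  have h := factorial_mul_choose r (n + 1)
  rw [descPochhammer_succ_eval, ← factorial_mul_choose r n, Nat.factorial_succ] at h
  push_cast at h
  exact mul_left_cancel₀ hn (by linear_combination h)

theorem derivative_binomialSeries (r : K) :
    (1 + X) * d⁄dX K (binomialSeries K r) = C r * binomialSeries K r := by
  ext n
  have hcoeff (k : ℕ) : intCoeff (k : ℤ) (binomialSeries K r) = Ring.choose r k := by
    simp [intCoeff_natCast]
  have h := succ_mul_choose_succ r n
  simp only [← intCoeff_natCast, add_mul, one_mul, map_add, intCoeff_X_mul, intCoeff_derivative,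
    intCoeff_C_mul, sub_add_cancel, hcoeff]
  rw [← Nat.cast_succ, hcoeff]
  push_cast
  linear_combination h

/-- The power series of `(1 - X) ^ p * (1 + X) ^ q`. -/
def binomialProd (p q : K) : K⟦X⟧ := rescale (-1) (binomialSeries K p) * binomialSeries K q

theorem binomialProd_mul (p q p' q' : K) :
    binomialProd p q * binomialProd p' q' = binomialProd (p + p') (q + q') := by
  simp only [binomialProd, binomialSeries_add, map_mul]
  ring

theorem binomialProd_natCast (m n : ℕ) :
    binomialProd (m : K) n = (1 - X) ^ m * (1 + X) ^ n := by
  simp only [binomialProd, binomialSeries_nat, map_pow, map_add, map_one, rescale_X, map_neg]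
  ring

theorem constantCoeff_binomialProd (p q : K) : constantCoeff (binomialProd p q) = 1 := by
  rw [binomialProd, map_mul, binomialSeries_constantCoeff, mul_one,
    ← coeff_zero_eq_constantCoeff_apply, coeff_rescale, pow_zero, one_mul,
    coeff_zero_eq_constantCoeff_apply, binomialSeries_constantCoeff]

theorem derivative_binomialProd (p q : K) :
    (1 - X ^ 2) * d⁄dX K (binomialProd p q) =
      (C (q - p) - C (p + q) * X) * binomialProd p q := by
  have hp := congrArg (rescale (-1)) (derivative_binomialSeries p)
  have hq := derivative_binomialSeries q
  simp only [map_mul, map_add, map_one, rescale_X, rescale_C, map_neg] at hp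
  simp only [binomialProd, Derivation.leibniz, smul_eq_mul, derivative_rescale, map_sub,
    map_add, map_neg, map_one]
  linear_combination (1 - X) * rescale (-1) (binomialSeries K p) * hq -
    (1 + X) * binomialSeries K q * hp

theorem intCoeff_binomialProd_add_two (p q : K) (n : ℤ) :
    (n + 2) * intCoeff (n + 2) (binomialProd p q) =
      (q - p) * intCoeff (n + 1) (binomialProd p q) +
        (n - (p + q)) * intCoeff n (binomialProd p q) := by
  have h := congrArg (intCoeff (n + 1)) (derivative_binomialProd p q)
  simp only [sub_mul, one_mul, mul_assoc, map_sub, intCoeff_C_mul, intCoeff_X_mul,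
    intCoeff_X_pow_mul, intCoeff_derivative] at h
  push_cast at h
  ring_nf at h ⊢
  linear_combination h

end FormalSeries

section BilinearSeries

variable {R : Type*} [CommRing R] {A B w : ℤ → R} {c α β : R}

theorem weight_mul (hw : ∀ n : ℤ, 0 ≤ n → (n + c) * w (n + 1) = (n + 1) * w n) {n : ℤ} {x : R}
    (hx : n < 0 → x = 0) : (n + c) * w (n + 1) * x = (n + 1) * w n * x := by
  rcases lt_or_ge n 0 with hn | hn
  · rw [hx hn, mul_zero, mul_zero]
  · rw [hw n hn]

theorem weight_mul_bilinear_add_two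
    (hA : ∀ n : ℤ, (n + 2) * A (n + 2) = α * A (n + 1) + (n + c) * A n)
    (hB : ∀ n : ℤ, (n + 2) * B (n + 2) = β * B (n + 1) + (n + c) * B n)
    (hw : ∀ n : ℤ, 0 ≤ n → (n + c) * w (n + 1) = (n + 1) * w n)
    (hA₀ : ∀ n < 0, A n = 0) (n : ℤ) :
    (n + 2) * (n + 1 + c) * (w (n + 2) * (A (n + 2) * B (n + 2))) =
      w (n + 1) * ((α * A (n + 1) + (n + c) * A n) * (β * B (n + 1) + (n + c) * B n)) := by
  have h := weight_mul hw (n := n + 1) (x := (n + 2) * (A (n + 2) * B (n + 2))) fun hn => by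
    rcases eq_or_ne n (-2) with rfl | hn'
    · norm_num
    · rw [hA₀ (n + 2) (by lia)]; ring
  rw [← hA, ← hB]
  simp only [add_assoc, Int.reduceAdd] at h
  push_cast at h
  linear_combination h

theorem bilinear_recurrence (hαβ : α + β = 2 - 2 * c)
    (hA : ∀ n : ℤ, (n + 2) * A (n + 2) = α * A (n + 1) + (n + c) * A n)
    (hB : ∀ n : ℤ, (n + 2) * B (n + 2) = β * B (n + 1) + (n + c) * B n)
    (hw : ∀ n : ℤ, 0 ≤ n → (n + c) * w (n + 1) = (n + 1) * w n)
    (hA₀ : ∀ n < 0, A n = 0) (hB₀ : ∀ n < 0, B n = 0) (k : ℤ) :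
    (k + 4) * (k + 3 + c) * (w (k + 4) * (A (k + 4) * B (k + 4))) -
      α * β * (w (k + 3) * (A (k + 3) * B (k + 3))) +
      (-2 * (k + 2) * (k + 1) - (2 * c + 2) * (k + 2) + 2 * (α * β) - 4 * c ^ 2 + 7 * c - 4) *
        (w (k + 2) * (A (k + 2) * B (k + 2))) -
      α * β * (w (k + 1) * (A (k + 1) * B (k + 1))) +
      (k + 1) * (k + c) * (w k * (A k * B k)) = 0 := by
  have e4 := weight_mul_bilinear_add_two hA hB hw hA₀ (k + 2)
  have hA3 := hA (k + 1)
  have hB3 := hB (k + 1)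
  have hw3 := weight_mul hw (n := k + 2) (x := α * A (k + 3) * B (k + 2) +
      β * A (k + 2) * B (k + 3) + (k + 2 + c) * A (k + 2) * B (k + 2)) fun hk => by
    rw [hA₀ _ hk, hB₀ _ hk]; ring
  have hw2 := weight_mul hw (n := k + 1) (x := (k + 2) * A (k + 2) * B (k + 2) -
      β * A (k + 2) * B (k + 1) - α * A (k + 1) * B (k + 2)) fun hk => by
    rw [hA₀ _ hk, hB₀ _ hk]
    rcases eq_or_ne k (-2) with rfl | hk'
    · norm_num
    · rw [hA₀ (k + 2) (by lia)]; ring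
  have hw1 := weight_mul hw (n := k) (x := (k + c) * (A k * B k)) fun hk => by
    rw [hA₀ k hk]; ring
  simp only [add_assoc, Int.reduceAdd] at e4 hA3 hB3 hw3 hw2
  push_cast at e4 hA3 hB3 hw3 hw2
  have e3 : w (k + 3) * (k + 2 + c) * (α * A (k + 3) * B (k + 2) + β * A (k + 2) * B (k + 3) +
        (k + 2 + c) * A (k + 2) * B (k + 2)) =
      w (k + 2) * (α * (α * A (k + 2) + (k + 1 + c) * A (k + 1)) * B (k + 2) +
        β * A (k + 2) * (β * B (k + 2) + (k + 1 + c) * B (k + 1)) +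
        (k + 3) * (k + 2 + c) * A (k + 2) * B (k + 2)) := by
    linear_combination hw3 + w (k + 2) * (α * B (k + 2) * hA3 + β * A (k + 2) * hB3)
  have e0 : (k + 1) * (k + c) * (w k * (A k * B k)) = w (k + 1) *
      (((k + 2) * A (k + 2) - α * A (k + 1)) * ((k + 2) * B (k + 2) - β * B (k + 1))) := by
    rw [hA, hB]
    linear_combination -hw1
  linear_combination e4 + e0 + e3 - hw2 +
    w (k + 2) * A (k + 2) * B (k + 2) * (α + β + (2 - 2 * c)) * hαβ

variable {K : Type*} [Field K]

theorem ascPochhammer_eval_ne_zero {c : K} (hc : ∀ n : ℕ, c + n ≠ 0) (n : ℕ) :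
    (ascPochhammer K n).eval c ≠ 0 := by
  induction n with
  | zero => simp
  | succ n ih => rw [ascPochhammer_succ_eval]; exact mul_ne_zero ih (hc n)

theorem factorial_div_ascPochhammer_succ {c : K} (hc : ∀ n : ℕ, c + n ≠ 0) (n : ℕ) :
    (n + c) * ((n + 1).factorial / (ascPochhammer K (n + 1)).eval c) =
      (n + 1) * (n.factorial / (ascPochhammer K n).eval c) := by
  have h1 := ascPochhammer_eval_ne_zero hc n
  have h2 := hc n
  rw [ascPochhammer_succ_eval, Nat.factorial_succ]
  push_cast
  field_simp
  ring

variable [CharZero K]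

/-- The series `∑ₘ m! / (c)ₘ Aₘ Bₘ Xᵐ`, where `A` and `B` are the coefficients of
`(1 - X) ^ (a - c) * (1 + X) ^ (-a)` and `(1 - X) ^ (b - c) * (1 + X) ^ (-b)`. -/
def bilinSeries (a b c : K) : K⟦X⟧ :=
  mk fun m => m.factorial / (ascPochhammer K m).eval c *
    (coeff m (binomialProd (a - c) (-a)) * coeff m (binomialProd (b - c) (-b)))

theorem intCoeff_bilinSeries (a b c : K) (n : ℤ) :
    intCoeff n (bilinSeries a b c) = n.toNat.factorial / (ascPochhammer K n.toNat).eval c *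
      (intCoeff n (binomialProd (a - c) (-a)) * intCoeff n (binomialProd (b - c) (-b))) := by
  rcases lt_or_ge n 0 with hn | hn
  · simp [intCoeff_of_neg hn]
  · lift n to ℕ using hn
    simp [intCoeff_natCast, bilinSeries]

theorem constantCoeff_bilinSeries (a b c : K) : constantCoeff (bilinSeries a b c) = 1 := by
  rw [← coeff_zero_eq_constantCoeff_apply, bilinSeries, coeff_mk,
    coeff_zero_eq_constantCoeff_apply, coeff_zero_eq_constantCoeff_apply,
    constantCoeff_binomialProd, constantCoeff_binomialProd]
  simp

variable {a b c : K}

theorem intCoeff_bilinSeries_recurrence (hc : ∀ n : ℕ, c + n ≠ 0) (hab : a + b + 1 = 2 * c)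
    (k : ℤ) :
    (k + 4) * (k + 3 + c) * intCoeff (k + 4) (bilinSeries a b c) -
      (c - 2 * a) * (c - 2 * b) * intCoeff (k + 3) (bilinSeries a b c) +
      (-2 * (k + 2) * (k + 1) - (2 * c + 2) * (k + 2) + 2 * ((c - 2 * a) * (c - 2 * b)) -
        4 * c ^ 2 + 7 * c - 4) * intCoeff (k + 2) (bilinSeries a b c) -
      (c - 2 * a) * (c - 2 * b) * intCoeff (k + 1) (bilinSeries a b c) +
      (k + 1) * (k + c) * intCoeff k (bilinSeries a b c) = 0 := by
  simp only [intCoeff_bilinSeries]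
  refine bilinear_recurrence (A := fun n => intCoeff n (binomialProd (a - c) (-a)))
    (B := fun n => intCoeff n (binomialProd (b - c) (-b)))
    (w := fun n => n.toNat.factorial / (ascPochhammer K n.toNat).eval c)
    (by linear_combination -2 * hab) (fun n => ?_) (fun n => ?_) (fun n hn => ?_)
    (fun n hn => intCoeff_of_neg hn _) (fun n hn => intCoeff_of_neg hn _) k
  · linear_combination intCoeff_binomialProd_add_two (a - c) (-a) n
  · linear_combination intCoeff_binomialProd_add_two (b - c) (-b) n
  · lift n to ℕ using hn
    exact_mod_cast factorial_div_ascPochhammer_succ hc n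

theorem bilinSeries_ode (hc : ∀ n : ℕ, c + n ≠ 0) (hab : a + b + 1 = 2 * c) :
    X * (1 - X ^ 2) ^ 2 * d⁄dX K (d⁄dX K (bilinSeries a b c)) +
      (1 - X ^ 2) * (C c - C (c + 2) * X ^ 2) * d⁄dX K (bilinSeries a b c) +
      (C (-((c - 2 * a) * (c - 2 * b))) * (1 + X ^ 2) +
        C (2 * ((c - 2 * a) * (c - 2 * b)) - 4 * c ^ 2 + 7 * c - 4) * X +
        C c * X ^ 3) * bilinSeries a b c = 0 := by
  refine ext_intCoeff fun n => ?_
  have h := intCoeff_bilinSeries_recurrence hc hab (n - 3)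
  set g := bilinSeries a b c
  set κ := (c - 2 * a) * (c - 2 * b)
  have expand : X * (1 - X ^ 2) ^ 2 * d⁄dX K (d⁄dX K g) +
      (1 - X ^ 2) * (C c - C (c + 2) * X ^ 2) * d⁄dX K g +
      (C (-κ) * (1 + X ^ 2) + C (2 * κ - 4 * c ^ 2 + 7 * c - 4) * X + C c * X ^ 3) * g =
      X ^ 1 * d⁄dX K (d⁄dX K g) - C 2 * (X ^ 3 * d⁄dX K (d⁄dX K g)) +
      X ^ 5 * d⁄dX K (d⁄dX K g) + C c * d⁄dX K g - C (2 * c + 2) * (X ^ 2 * d⁄dX K g) +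
      C (c + 2) * (X ^ 4 * d⁄dX K g) + C (-κ) * g +
      C (2 * κ - 4 * c ^ 2 + 7 * c - 4) * (X ^ 1 * g) + C (-κ) * (X ^ 2 * g) +
      C c * (X ^ 3 * g) := by
    simp only [map_add C, map_mul C, map_ofNat C 2]
    ring
  rw [expand]
  simp only [map_add (intCoeff n), map_sub (intCoeff n), intCoeff_C_mul, intCoeff_X_pow_mul,
    intCoeff_derivative, map_zero]
  push_cast at h ⊢
  ring_nf at h ⊢
  linear_combination h

end BilinearSeries

section RadialEquation

variable {R : Type*} [CommRing R]

/-- The Gauss operator `z(1-z) ∂_z² + (c - (a+b+1)z) ∂_z - ab`, `a + b + 1 = 2c`, `ab = m`, in the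
coordinate `X` with `z = 4X/(1+X)²`, up to a factor. -/
def radialOp (c m : R) (f : R⟦X⟧) : R⟦X⟧ :=
  X * (1 + X) ^ 2 * (1 - X) * d⁄dX R (d⁄dX R f) +
    (1 + X) * (C c * (1 - 6 * X + X ^ 2) + 4 * X - 2 * X ^ 2) * d⁄dX R f -
    4 * C m * (1 - X) * f

theorem radialOp_sub (c m : R) (f g : R⟦X⟧) :
    radialOp c m (f - g) = radialOp c m f - radialOp c m g := by
  simp only [radialOp, map_sub]
  ring

theorem intCoeff_radialOp (c m : R) (f : R⟦X⟧) (n : ℤ) :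
    intCoeff n (radialOp c m f) =
      (n + 1) * (n + c) * intCoeff (n + 1) f +
        ((n - 1 + 4 - 5 * c) * n - 4 * m) * intCoeff n f +
        ((n - 1) * (-(n - 2) + 2 - 5 * c) + 4 * m) * intCoeff (n - 1) f +
        (n - 2) * (-(n - 3) + c - 2) * intCoeff (n - 2) f := by
  have expand : radialOp c m f =
      X ^ 1 * d⁄dX R (d⁄dX R f) + X ^ 2 * d⁄dX R (d⁄dX R f) - X ^ 3 * d⁄dX R (d⁄dX R f) -
      X ^ 4 * d⁄dX R (d⁄dX R f) + C c * d⁄dX R f + C (4 - 5 * c) * (X ^ 1 * d⁄dX R f) +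
      C (2 - 5 * c) * (X ^ 2 * d⁄dX R f) + C (c - 2) * (X ^ 3 * d⁄dX R f) -
      C (4 * m) * f + C (4 * m) * (X ^ 1 * f) := by
    simp only [radialOp, map_sub C, map_mul C, map_ofNat C]
    ring
  rw [expand]
  simp only [map_add (intCoeff n), map_sub (intCoeff n), intCoeff_C_mul, intCoeff_X_pow_mul,
    intCoeff_derivative]
  push_cast
  ring_nf

variable {K : Type*} [Field K] [CharZero K] {a b c m : K}

theorem eq_zero_of_radialOp (hc : ∀ n : ℕ, c + n ≠ 0) {f : K⟦X⟧} (hf : radialOp c m f = 0)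
    (h0 : constantCoeff f = 0) : f = 0 := by
  ext n
  rw [map_zero]
  induction n using Nat.strong_induction_on with
  | _ n ih =>
    rcases n with _ | n
    · rwa [coeff_zero_eq_constantCoeff_apply]
    have ih' (k : ℤ) (hk : k < n + 1) : intCoeff k f = 0 := by
      rcases lt_or_ge k 0 with hk0 | hk0
      · exact intCoeff_of_neg hk0 f
      · lift k to ℕ using hk0
        rw [intCoeff_natCast, ih k (by lia)]
    have h := intCoeff_radialOp c m f n
    rw [hf, map_zero, ih' n (by lia), ih' (n - 1) (by lia), ih' (n - 2) (by lia)] at h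
    have hn : ((n : K) + 1) * (c + n) ≠ 0 := mul_ne_zero n.cast_add_one_ne_zero (hc n)
    rw [← intCoeff_natCast]
    refine (mul_eq_zero.1 (?_ : ((n : K) + 1) * (c + n) * _ = 0)).resolve_left hn
    push_cast at h ⊢
    linear_combination -h

theorem eq_of_radialOp (hc : ∀ n : ℕ, c + n ≠ 0) {f g : K⟦X⟧} (hf : radialOp c m f = 0)
    (hg : radialOp c m g = 0) (h0 : constantCoeff f = constantCoeff g) : f = g :=
  sub_eq_zero.1 <| eq_zero_of_radialOp hc (by rw [radialOp_sub, hf, hg, sub_zero])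
    (by rw [map_sub, h0, sub_self])

/-- The series `(1 - X) ^ (1 - c) * (1 + X) ^ (2 * c - 1) * ∑ₘ m! / (c)ₘ Aₘ Bₘ Xᵐ`; for
`c = (d + 1) / 2` it is the generating function of the coefficients `bₙ`. -/
def bSeries (a b c : K) : K⟦X⟧ := binomialProd (1 - c) (2 * c - 1) * bilinSeries a b c

theorem constantCoeff_bSeries (a b c : K) : constantCoeff (bSeries a b c) = 1 := by
  rw [bSeries, map_mul, constantCoeff_binomialProd, constantCoeff_bilinSeries, one_mul]

theorem derivative_derivative_binomialProd (p q : K) :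
    (1 - X ^ 2) * d⁄dX K (d⁄dX K (binomialProd p q)) =
      (C (q - p) - C (p + q) * X + 2 * X) * d⁄dX K (binomialProd p q) -
        C (p + q) * binomialProd p q := by
  have h := congrArg (d⁄dX K) (derivative_binomialProd p q)
  simp only [Derivation.leibniz, smul_eq_mul, map_sub (d⁄dX K), derivative_one, derivative_pow,
    derivative_X, derivative_C] at h
  norm_num at h
  simp only [map_sub, map_add]
  linear_combination h

theorem radialOp_bSeries (hc : ∀ n : ℕ, c + n ≠ 0) (hab : a + b + 1 = 2 * c) :
    radialOp c (a * b) (bSeries a b c) = 0 := by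
  have hode := bilinSeries_ode hc hab
  have hy1 := derivative_binomialProd (1 - c) (2 * c - 1)
  have hy2 := derivative_derivative_binomialProd (1 - c) (2 * c - 1)
  rw [show (c - 2 * a) * (c - 2 * b) = 4 * (a * b) + 2 * c - 3 * c ^ 2 by
    linear_combination -2 * c * hab] at hode
  refine (mul_eq_zero.1 (?_ : (1 - X : K⟦X⟧) * _ = 0)).resolve_left fun h => by
    simpa using congrArg constantCoeff h
  rw [bSeries, radialOp]
  simp only [Derivation.leibniz, smul_eq_mul, map_add, map_sub, map_mul, map_neg, map_pow, map_one,
    map_ofNat C] at hode hy1 hy2 ⊢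
  generalize binomialProd (1 - c) (2 * c - 1) = y at *
  generalize bilinSeries a b c = g at *
  linear_combination y * hode + X * (1 - X ^ 2) * g * hy2 +
    (2 * X * (1 - X ^ 2) * d⁄dX K g +
      (C c * (1 - 6 * X + X ^ 2) + 4 * X - 2 * X ^ 2) * g +
      X * (3 * C c - 2 - C c * X + 2 * X) * g) * hy1

end RadialEquation

section GaussSeries

variable {K : Type*} [Field K]

/-- The Gauss series `∑ₖ (a)ₖ (b)ₖ / ((c)ₖ k!) Xᵏ` of `₂F₁(a, b; c; z)`. -/
def gaussSeries (a b c : K) : K⟦X⟧ :=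
  mk fun k => (ascPochhammer K k).eval a * (ascPochhammer K k).eval b /
    ((ascPochhammer K k).eval c * k.factorial)

theorem constantCoeff_gaussSeries (a b c : K) : constantCoeff (gaussSeries a b c) = 1 := by
  simp [gaussSeries, ← coeff_zero_eq_constantCoeff_apply]

theorem gaussSeries_comm (a b c : K) : gaussSeries a b c = gaussSeries b a c := by
  simp only [gaussSeries, mul_comm]

variable [CharZero K]

theorem derivative_gaussSeries (a b c : K) :
    d⁄dX K (gaussSeries a b c) = C (a * b / c) * gaussSeries (a + 1) (b + 1) (c + 1) := by
  have hsucc (x : K) (n : ℕ) :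
      (ascPochhammer K (n + 1)).eval x = x * (ascPochhammer K n).eval (x + 1) := by
    rw [ascPochhammer_succ_left, Polynomial.eval_mul, Polynomial.eval_comp]
    simp
  ext n
  have hn : (n : K) + 1 ≠ 0 := n.cast_add_one_ne_zero
  simp only [coeff_derivative, coeff_C_mul, gaussSeries, coeff_mk, hsucc, Nat.factorial_succ]
  push_cast
  field_simp

variable {a b c : K}

theorem intCoeff_gaussSeries_add_one (hc : ∀ n : ℕ, c + n ≠ 0) (n : ℤ) :
    (n + 1) * (n + c) * intCoeff (n + 1) (gaussSeries a b c) =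
      (n + a) * (n + b) * intCoeff n (gaussSeries a b c) := by
  rcases lt_or_ge n 0 with hn | hn
  · rw [intCoeff_of_neg hn, mul_zero]
    rcases eq_or_ne n (-1) with rfl | hn'
    · norm_num
    · rw [intCoeff_of_neg (by lia), mul_zero]
  lift n to ℕ using hn
  have h1 := ascPochhammer_eval_ne_zero hc n
  have h2 := hc n
  have h3 : (n : K) + 1 ≠ 0 := n.cast_add_one_ne_zero
  have h4 : (n.factorial : K) ≠ 0 := by exact_mod_cast n.factorial_ne_zero
  rw [← Nat.cast_succ, intCoeff_natCast, intCoeff_natCast]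
  simp only [gaussSeries, coeff_mk, ascPochhammer_succ_eval, Nat.factorial_succ]
  push_cast
  field_simp
  ring

theorem gaussSeries_ode (hc : ∀ n : ℕ, c + n ≠ 0) :
    X * (1 - X) * d⁄dX K (d⁄dX K (gaussSeries a b c)) +
      (C c - C (a + b + 1) * X) * d⁄dX K (gaussSeries a b c) -
      C (a * b) * gaussSeries a b c = 0 := by
  refine ext_intCoeff fun n => ?_
  have h := intCoeff_gaussSeries_add_one (a := a) (b := b) hc n
  set U := gaussSeries a b c
  have expand : X * (1 - X) * d⁄dX K (d⁄dX K U) + (C c - C (a + b + 1) * X) * d⁄dX K U -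
      C (a * b) * U =
      X ^ 1 * d⁄dX K (d⁄dX K U) - X ^ 2 * d⁄dX K (d⁄dX K U) + C c * d⁄dX K U -
      C (a + b + 1) * (X ^ 1 * d⁄dX K U) - C (a * b) * U := by ring
  rw [expand]
  simp only [map_add (intCoeff n), map_sub (intCoeff n), intCoeff_C_mul, intCoeff_X_pow_mul,
    intCoeff_derivative, map_zero]
  push_cast
  ring_nf at h ⊢
  linear_combination h

end GaussSeries

section RadialVariable

/-- The expansion `4X/(1+X)² = ∑ₙ 4 (-1)ⁿ⁺¹ n Xⁿ` of `z = (1+σ)/2` in the radial variable. -/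
def radialZ (R : Type*) [CommRing R] : R⟦X⟧ := mk fun n => -4 * (n * (-1) ^ n)

theorem constantCoeff_radialZ (R : Type*) [CommRing R] : constantCoeff (radialZ R) = 0 := by
  simp [radialZ, ← coeff_zero_eq_constantCoeff_apply]

theorem radialZ_mul (R : Type*) [CommRing R] : radialZ R * (1 + X) ^ 2 = 4 * X := by
  have expand : radialZ R * (1 + X) ^ 2 =
      radialZ R + C 2 * (X ^ 1 * radialZ R) + X ^ 2 * radialZ R := by
    rw [map_ofNat C 2]
    ring
  rw [expand, ← map_ofNat (C (R := R)) 4]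
  ext n
  simp only [map_add (coeff n), coeff_C_mul, coeff_X_pow_mul', radialZ, coeff_mk, coeff_X]
  rcases n with _ | _ | n
  · simp
  · simp
  · simp
    ring

end RadialVariable

section RadialSubstitution

theorem hasSubst_radialZ (R : Type*) [CommRing R] : HasSubst (radialZ R) :=
  HasSubst.of_constantCoeff_zero' (constantCoeff_radialZ R)

theorem derivative_radialZ (R : Type*) [CommRing R] :
    d⁄dX R (radialZ R) * (1 + X) ^ 3 = 4 * (1 - X) := by
  have h := congrArg (d⁄dX R) (radialZ_mul R)
  rw [← map_ofNat (C (R := R)) 4] at h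
  simp only [Derivation.leibniz, smul_eq_mul, map_add, derivative_one, derivative_pow,
    derivative_X, derivative_C] at h
  norm_num at h
  rw [map_ofNat C 4] at h
  linear_combination (1 + X) * h - 2 * radialZ_mul R

theorem derivative_derivative_radialZ (R : Type*) [CommRing R] :
    d⁄dX R (d⁄dX R (radialZ R)) * (1 + X) ^ 4 = -4 * (1 + X) - 12 * (1 - X) := by
  have h := congrArg (d⁄dX R) (derivative_radialZ R)
  rw [← map_ofNat (C (R := R)) 4] at h
  simp only [Derivation.leibniz, smul_eq_mul, map_add, map_sub, derivative_one, derivative_pow,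
    derivative_X, derivative_C] at h
  norm_num at h
  rw [map_ofNat C 4] at h
  linear_combination (1 + X) * h - 3 * derivative_radialZ R

variable {K : Type*} [Field K]

/-- The Gauss series of `₂F₁(a, b; c; 4X/(1+X)²)`. -/
def fSeries (a b c : K) : K⟦X⟧ := (gaussSeries a b c).subst (radialZ K)

theorem fSeries_comm (a b c : K) : fSeries a b c = fSeries b a c := by
  rw [fSeries, gaussSeries_comm, fSeries]

theorem constantCoeff_fSeries (a b c : K) : constantCoeff (fSeries a b c) = 1 := by
  rw [fSeries, ← coeff_zero_eq_constantCoeff_apply, coeff_subst' (hasSubst_radialZ K),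
    finsum_eq_single _ 0]
  · simp [constantCoeff_gaussSeries]
  · intro n hn
    simp [constantCoeff_radialZ, hn]

variable [CharZero K] {a b c : K}

theorem derivative_fSeries (a b c : K) :
    (1 + X) ^ 3 * d⁄dX K (fSeries a b c) =
      C (4 * (a * b / c)) * ((1 - X) * fSeries (a + 1) (b + 1) (c + 1)) := by
  have hderiv : d⁄dX K (fSeries a b c) =
      C (a * b / c) * fSeries (a + 1) (b + 1) (c + 1) * d⁄dX K (radialZ K) := by
    rw [fSeries, derivative_subst (hasSubst_radialZ K), derivative_gaussSeries, ← smul_eq_C_mul,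
      subst_smul (hasSubst_radialZ K), smul_eq_C_mul, fSeries]
  rw [hderiv, map_mul, map_ofNat (C (R := K))]
  linear_combination C (a * b / c) * fSeries (a + 1) (b + 1) (c + 1) * derivative_radialZ K

theorem radialOp_fSeries (hc : ∀ n : ℕ, c + n ≠ 0) (hab : a + b + 1 = 2 * c) :
    radialOp c (a * b) (fSeries a b c) = 0 := by
  have hs := hasSubst_radialZ K
  have hode := congrArg (substAlgHom hs) (gaussSeries_ode (a := a) (b := b) hc)
  have h1 : d⁄dX K (fSeries a b c) =
      substAlgHom hs (d⁄dX K (gaussSeries a b c)) * d⁄dX K (radialZ K) := by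
    rw [fSeries, derivative_subst hs, coe_substAlgHom]
  have h2 : d⁄dX K (d⁄dX K (fSeries a b c)) =
      substAlgHom hs (d⁄dX K (d⁄dX K (gaussSeries a b c))) * d⁄dX K (radialZ K) ^ 2 +
        substAlgHom hs (d⁄dX K (gaussSeries a b c)) * d⁄dX K (d⁄dX K (radialZ K)) := by
    rw [h1, Derivation.leibniz, coe_substAlgHom, derivative_subst hs]
    simp only [smul_eq_mul]
    ring
  have hC (r : K) : substAlgHom hs (C r) = C r := (substAlgHom hs).commutes r
  have h0 : fSeries a b c = substAlgHom hs (gaussSeries a b c) := by rw [coe_substAlgHom, fSeries]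
  simp only [map_add, map_sub, map_mul, map_zero, map_one, substAlgHom_X, hC] at hode
  rw [← map_add C, ← map_one C, ← map_add C, hab, map_one, ← map_mul C, map_mul C 2,
    map_ofNat C 2] at hode
  have z0 := radialZ_mul K
  have z1 := derivative_radialZ K
  have z2 := derivative_derivative_radialZ K
  have hne : (1 + X : K⟦X⟧) ^ 4 ≠ 0 := pow_ne_zero _ fun h => by
    simpa using congrArg constantCoeff h
  refine (mul_eq_zero.1 ?_).resolve_left hne
  rw [radialOp, h2, h1, h0]
  generalize substAlgHom hs (d⁄dX K (d⁄dX K (gaussSeries a b c))) = U2 at *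
  generalize substAlgHom hs (d⁄dX K (gaussSeries a b c)) = U1 at *
  generalize substAlgHom hs (gaussSeries a b c) = U0 at *
  linear_combination 4 * (1 - X) * (1 + X) ^ 4 * hode +
    X * (1 - X) * U2 * (d⁄dX K (radialZ K) * (1 + X) ^ 3 + 4 * (1 - X)) * z1 +
    X * (1 + X) ^ 2 * (1 - X) * U1 * z2 +
    (1 + X) ^ 2 * (C c * (1 - 6 * X + X ^ 2) + 4 * X - 2 * X ^ 2) * U1 * z1
    - 4 * (1 - X) * U2 * ((1 + X) ^ 2 - radialZ K * (1 + X) ^ 2 - 4 * X) * z0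
    + 8 * (1 - X) * C c * (1 + X) ^ 2 * U1 * z0

theorem bSeries_eq_fSeries (hc : ∀ n : ℕ, c + n ≠ 0) (hab : a + b + 1 = 2 * c) :
    bSeries a b c = fSeries a b c :=
  eq_of_radialOp hc (radialOp_bSeries hc hab) (radialOp_fSeries hc hab)
    (by rw [constantCoeff_bSeries, constantCoeff_fSeries])

theorem gaussSeries_contiguous (hc : ∀ n : ℕ, c + n ≠ 0) (hab : a + b + 1 = 2 * c) :
    C (a * (a + 1)) * gaussSeries (a + 2) b (c + 1) =
      C ((a - b) * (2 * c)) * gaussSeries a b c +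
        C (b * (b + 1)) * gaussSeries a (b + 2) (c + 1) := by
  have hsucc (x : K) (n : ℕ) :
      x * (ascPochhammer K n).eval (x + 1) = (ascPochhammer K n).eval x * (x + n) := by
    rw [← ascPochhammer_succ_eval, ascPochhammer_succ_left, Polynomial.eval_mul,
      Polynomial.eval_comp]
    simp
  have hsucc2 (x : K) (n : ℕ) : x * (x + 1) * (ascPochhammer K n).eval (x + 2) =
      (ascPochhammer K n).eval x * (x + n) * (x + n + 1) := by
    have h := hsucc (x + 1) n
    rw [show x + 1 + 1 = x + 2 by ring] at h
    linear_combination x * h + (x + 1 + n) * hsucc x n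
  ext k
  have hc0 : c ≠ 0 := by simpa using hc 0
  have hck := ascPochhammer_eval_ne_zero hc k
  have hck1 : (ascPochhammer K k).eval (c + 1) ≠ 0 := ascPochhammer_eval_ne_zero (fun n => by
    have := hc (n + 1)
    push_cast at this
    rwa [add_right_comm, add_assoc]) k
  have hfac : (k.factorial : K) ≠ 0 := by exact_mod_cast k.factorial_ne_zero
  have hc1 := hsucc c k
  have ha2 := hsucc2 a k
  have hb2 := hsucc2 b k
  simp only [map_add, coeff_C_mul, gaussSeries, coeff_mk]
  generalize (ascPochhammer K k).eval (c + 1) = pc1 at *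
  generalize (ascPochhammer K k).eval c = pc at *
  generalize (ascPochhammer K k).eval (a + 2) = pa2 at *
  generalize (ascPochhammer K k).eval (b + 2) = pb2 at *
  generalize (ascPochhammer K k).eval a = pa at *
  generalize (ascPochhammer K k).eval b = pb at *
  field_simp
  linear_combination pb * pc * ha2 - pa * pc * hb2 + pa * pb * pc * (a - b) * hab -
    (a - b) * 2 * pa * pb * hc1

theorem fSeries_contiguous (hc : ∀ n : ℕ, c + n ≠ 0) (hab : a + b + 1 = 2 * c) :
    C (a * (a + 1)) * fSeries (a + 2) b (c + 1) =
      C ((a - b) * (2 * c)) * fSeries a b c + C (b * (b + 1)) * fSeries a (b + 2) (c + 1) := by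
  have hs := hasSubst_radialZ K
  have h := congrArg (substAlgHom hs) (gaussSeries_contiguous hc hab)
  have hC (r : K) : substAlgHom hs (C r) = C r := (substAlgHom hs).commutes r
  simp only [map_add (substAlgHom hs), map_mul (substAlgHom hs), hC, coe_substAlgHom] at h
  exact h

end RadialSubstitution

section NonnegCoeffs

/-- All coefficients of the power series `f` are nonnegative. -/
def NonnegCoeffs {R : Type*} [Semiring R] [LE R] (f : R⟦X⟧) : Prop := ∀ n, 0 ≤ coeff n f

variable {R : Type*} [Semiring R] [PartialOrder R] [IsOrderedRing R] {f g : R⟦X⟧}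

theorem NonnegCoeffs.mul (hf : NonnegCoeffs f) (hg : NonnegCoeffs g) : NonnegCoeffs (f * g) :=
  fun n => by
    rw [coeff_mul]
    exact Finset.sum_nonneg fun i _ => mul_nonneg (hf _) (hg _)

theorem NonnegCoeffs.add (hf : NonnegCoeffs f) (hg : NonnegCoeffs g) : NonnegCoeffs (f + g) :=
  fun n => by
    rw [map_add]
    exact add_nonneg (hf _) (hg _)

theorem NonnegCoeffs.C_mul {r : R} (hr : 0 ≤ r) (hf : NonnegCoeffs f) : NonnegCoeffs (C r * f) :=
  fun n => by
    rw [coeff_C_mul]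
    exact mul_nonneg hr (hf _)

theorem nonnegCoeffs_one_add_X_pow (n : ℕ) : NonnegCoeffs ((1 + X : R⟦X⟧) ^ n) := by
  have h1 : NonnegCoeffs (1 : R⟦X⟧) := fun n => by
    rw [coeff_one]
    split_ifs <;> simp
  have hX : NonnegCoeffs (X : R⟦X⟧) := fun n => by
    rw [coeff_X]
    split_ifs <;> simp
  induction n with
  | zero => rwa [pow_zero]
  | succ n ih =>
    rw [pow_succ]
    exact ih.mul (h1.add hX)

end NonnegCoeffs

section OrderedField

variable {K : Type*} [Field K] [LinearOrder K] [IsStrictOrderedRing K] {a b c : K}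

theorem NonnegCoeffs.of_C_mul {r : K} (hr : 0 < r) {f : K⟦X⟧} (hf : NonnegCoeffs (C r * f)) :
    NonnegCoeffs f := fun n => by
  have h := hf n
  rw [coeff_C_mul] at h
  exact nonneg_of_mul_nonneg_right h hr

theorem NonnegCoeffs.of_derivative {f : K⟦X⟧} (h0 : 0 ≤ constantCoeff f)
    (h : NonnegCoeffs (d⁄dX K f)) : NonnegCoeffs f := by
  rintro (_ | n)
  · rwa [coeff_zero_eq_constantCoeff_apply]
  · have hn := h n
    rw [coeff_derivative] at hn
    exact nonneg_of_mul_nonneg_left hn n.cast_add_one_pos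

theorem nonnegCoeffs_rescale_neg_one_binomialSeries {p : K} (hp : p ≤ 0) :
    NonnegCoeffs (rescale (-1) (binomialSeries K p)) := fun n => by
  rw [coeff_rescale, binomialSeries_coeff, smul_eq_mul, mul_one]
  induction n with
  | zero => simp
  | succ n ih =>
    have hn : (0 : K) < n + 1 := n.cast_add_one_pos
    have h : (-1) ^ (n + 1) * Ring.choose p (n + 1) =
        (n - p) / (n + 1) * ((-1) ^ n * Ring.choose p n) := by
      field_simp
      linear_combination -(-1) ^ n * succ_mul_choose_succ p n
    rw [h]
    exact mul_nonneg (div_nonneg (by linarith [n.cast_nonneg (α := K)]) hn.le) ih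

theorem nonnegCoeffs_binomialProd {p : K} (hp : p ≤ 0) (n : ℕ) :
    NonnegCoeffs (binomialProd p n) := by
  rw [binomialProd, binomialSeries_nat]
  exact (nonnegCoeffs_rescale_neg_one_binomialSeries hp).mul (nonnegCoeffs_one_add_X_pow n)

theorem neg_one_pow_mul_coeff_binomialProd_nonneg {p q : K} (hqp : q ≤ p) (hpq : p + q ≤ 0)
    (n : ℕ) : 0 ≤ (-1) ^ n * coeff n (binomialProd p q) := by
  have hrec (n : ℤ) := intCoeff_binomialProd_add_two p q n
  rw [← intCoeff_natCast]
  induction n using Nat.twoStepInduction with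
  | zero => simp [intCoeff_zero, constantCoeff_binomialProd]
  | one =>
    have h := hrec (-1)
    norm_num [intCoeff_of_neg, intCoeff_zero, constantCoeff_binomialProd] at h ⊢
    linarith
  | more n ih0 ih1 =>
    have hn : (0 : K) < n + 2 := by positivity
    have h := hrec n
    push_cast at h ih1 ⊢
    refine nonneg_of_mul_nonneg_right (?_ : 0 ≤ ((n : K) + 2) * _) hn
    have : ((n : K) + 2) * ((-1) ^ (n + 2) * intCoeff (n + 2) (binomialProd p q)) =
        (p - q) * ((-1) ^ (n + 1) * intCoeff (n + 1) (binomialProd p q)) +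
          (n - (p + q)) * ((-1) ^ n * intCoeff n (binomialProd p q)) := by
      linear_combination (-1) ^ n * h
    rw [this]
    exact add_nonneg (mul_nonneg (by linarith) ih1)
      (mul_nonneg (by linarith [n.cast_nonneg (α := K)]) ih0)

theorem ascPochhammer_eval_nonneg (hc : 0 ≤ c) (n : ℕ) : 0 ≤ (ascPochhammer K n).eval c := by
  induction n with
  | zero => simp
  | succ n ih =>
    rw [ascPochhammer_succ_eval]
    exact mul_nonneg ih (add_nonneg hc n.cast_nonneg)

theorem nonnegCoeffs_bilinSeries (hc : 0 ≤ c) (ha : c ≤ 2 * a) (hb : c ≤ 2 * b) :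
    NonnegCoeffs (bilinSeries a b c) := fun m => by
  have hA := neg_one_pow_mul_coeff_binomialProd_nonneg
    (by linarith : -a ≤ a - c) (by linarith) m
  have hB := neg_one_pow_mul_coeff_binomialProd_nonneg
    (by linarith : -b ≤ b - c) (by linarith) m
  have hAB := mul_nonneg hA hB
  rw [mul_mul_mul_comm, ← mul_pow, neg_one_mul, neg_neg, one_pow, one_mul] at hAB
  rw [bilinSeries, coeff_mk]
  exact mul_nonneg (div_nonneg (Nat.cast_nonneg _) (ascPochhammer_eval_nonneg hc m)) hAB

theorem add_natCast_ne_zero_of_pos (hc : 0 < c) (n : ℕ) : c + n ≠ 0 := by positivity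

theorem derivative_fSeries_eq_binomialProd_mul (hc : 0 < c) (hab : a + b + 1 = 2 * c) :
    d⁄dX K (fSeries a b c) = C (4 * (a * b / c)) *
      (binomialProd (1 - c) (2 * c - 2) * bilinSeries (a + 1) (b + 1) (c + 1)) := by
  have hne : (1 + X : K⟦X⟧) ^ 3 ≠ 0 := pow_ne_zero _ fun h => by
    simpa using congrArg constantCoeff h
  refine mul_left_cancel₀ hne ?_
  have hprod : (1 - X) * binomialProd (1 - (c + 1)) (2 * (c + 1) - 1) =
      (1 + X) ^ 3 * binomialProd (1 - c) (2 * c - 2) := by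
    have h1 : (1 - X : K⟦X⟧) = binomialProd 1 0 := by
      simpa using (binomialProd_natCast (K := K) 1 0).symm
    have h3 : ((1 + X) ^ 3 : K⟦X⟧) = binomialProd 0 3 := by
      simpa using (binomialProd_natCast (K := K) 0 3).symm
    rw [h1, h3, binomialProd_mul, binomialProd_mul]
    ring_nf
  rw [derivative_fSeries, ← bSeries_eq_fSeries (add_natCast_ne_zero_of_pos (by linarith))
    (by linarith), bSeries]
  linear_combination C (4 * (a * b / c)) * bilinSeries (a + 1) (b + 1) (c + 1) * hprod

theorem nonnegCoeffs_fSeries_of_le {d : ℕ} (hd : 2 * c = d + 2) (hab : a + b + 1 = 2 * c)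
    (ha : 0 ≤ a) (hb : 0 ≤ b) (hab' : a ≤ 3 * b + 1) (hba' : b ≤ 3 * a + 1) :
    NonnegCoeffs (fSeries a b c) := by
  have hd0 : (0 : K) ≤ d := d.cast_nonneg
  refine .of_derivative (by rw [constantCoeff_fSeries]; exact zero_le_one) ?_
  rw [derivative_fSeries_eq_binomialProd_mul (by linarith) hab,
    show 2 * c - 2 = d by linarith]
  refine .C_mul ?_ ((nonnegCoeffs_binomialProd (by linarith) d).mul
    (nonnegCoeffs_bilinSeries (by linarith) (by linarith) (by linarith)))
  have : 0 ≤ c := by linarith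
  positivity

theorem NonnegCoeffs.fSeries_add_two (hc : 0 < c) (hab : a + b + 1 = 2 * c) (ha : 0 < a)
    (hb : 0 ≤ b) (hba : b ≤ a) (h : NonnegCoeffs (fSeries a b c))
    (h' : NonnegCoeffs (fSeries a (b + 2) (c + 1))) :
    NonnegCoeffs (fSeries (a + 2) b (c + 1)) := by
  refine .of_C_mul (r := a * (a + 1)) (by positivity) ?_
  rw [fSeries_contiguous (add_natCast_ne_zero_of_pos hc) hab]
  exact (h.C_mul (mul_nonneg (by linarith) (by linarith))).add (h'.C_mul (by positivity))

/-- Since the contiguity relation lowers the larger parameter by `2`, the recursion on the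
difference of the parameters ends in the range where the derivative is manifestly positive. -/
theorem nonnegCoeffs_fSeries_add_one [Archimedean K] {d : ℕ} (hd : 2 * c = d + 2)
    (ih : ∀ a b : K, 0 < a → 0 < b → a + b + 1 = 2 * c → NonnegCoeffs (fSeries a b c))
    (ha : 0 < a) (hb : 0 < b) (hab : a + b + 1 = 2 * (c + 1)) :
    NonnegCoeffs (fSeries a b (c + 1)) := by
  have hd0 : (0 : K) ≤ d := d.cast_nonneg
  wlog hba : b ≤ a generalizing a b
  · rw [fSeries_comm]
    exact this hb ha (by linarith) (le_of_not_ge hba)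
  obtain ⟨k, hk⟩ := exists_nat_ge (a - b)
  replace hk : a - b ≤ 2 * (k + 1) := by linarith [k.cast_nonneg (α := K)]
  induction k generalizing a b with
  | zero =>
    rw [Nat.cast_zero, zero_add, mul_one] at hk
    exact nonnegCoeffs_fSeries_of_le (d := d + 2) (by push_cast; linarith) hab ha.le hb.le
      (by linarith) (by linarith)
  | succ k ihk =>
    rcases le_or_gt a (3 * b + 1) with h | h
    · exact nonnegCoeffs_fSeries_of_le (d := d + 2) (by push_cast; linarith) hab ha.le hb.le h
        (by linarith)
    push_cast at hk
    have hlow : NonnegCoeffs (fSeries (a - 2) b c) := ih _ _ (by linarith) hb (by linarith)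
    have hflat : NonnegCoeffs (fSeries (a - 2) (b + 2) (c + 1)) := by
      rcases le_total (b + 2) (a - 2) with h' | h'
      · exact ihk (by linarith) (by linarith) (by linarith) h' (by linarith)
      · rw [fSeries_comm]
        exact ihk (by linarith) (by linarith) (by linarith) h'
          (by linarith [k.cast_nonneg (α := K)])
    simpa only [sub_add_cancel] using
      hlow.fSeries_add_two (by linarith) (by linarith) (by linarith) hb.le (by linarith) hflat

end OrderedField

section ThreeHalves

variable {K : Type*} [Field K] [CharZero K] (μ : K)

/-- The coefficients of `(1 - t)^(2 - μ) * (1 + t)^(2 + μ)`, indexed by `ℤ`. -/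
def quarticCoeff (n : ℤ) : K := intCoeff n (binomialProd (2 - μ) (2 + μ))

theorem quarticCoeff_add_two (n : ℤ) : (n + 2) * quarticCoeff μ (n + 2) =
    2 * μ * quarticCoeff μ (n + 1) + (n - 4) * quarticCoeff μ n := by
  have h := intCoeff_binomialProd_add_two (2 - μ) (2 + μ) n
  rw [quarticCoeff, quarticCoeff, quarticCoeff]
  linear_combination h

theorem quarticCoeff_of_neg {n : ℤ} (hn : n < 0) : quarticCoeff μ n = 0 := intCoeff_of_neg hn _

theorem quarticCoeff_one : quarticCoeff μ 1 = 2 * μ := by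
  have h := quarticCoeff_add_two μ (-1)
  have h0 : quarticCoeff μ 0 = 1 := by
    rw [quarticCoeff, intCoeff_zero, constantCoeff_binomialProd]
  norm_num [quarticCoeff_of_neg, h0] at h
  exact h

theorem quarticCoeff_odd (n : ℤ) :
    2 * (n + 1) * (2 * n + 3) * quarticCoeff μ (2 * n + 3) =
      (4 * μ ^ 2 + (8 * n * (n - 1) - 10)) * quarticCoeff μ (2 * n + 1) -
        2 * (n - 2) * (2 * n - 5) * quarticCoeff μ (2 * n - 1) := by
  have h1 := quarticCoeff_add_two μ (2 * n + 1)
  have h2 := quarticCoeff_add_two μ (2 * n)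
  have h3 := quarticCoeff_add_two μ (2 * n - 1)
  push_cast at h1 h2 h3
  ring_nf at h1 h2 h3 ⊢
  linear_combination (2 * n + 2) * h1 + 2 * μ * h2 - (2 * n - 4) * h3

theorem quarticCoeff_three : 3 * quarticCoeff μ 3 = 2 * μ * (2 * μ ^ 2 - 5) := by
  have h := quarticCoeff_odd μ 0
  norm_num [quarticCoeff_of_neg, quarticCoeff_one] at h
  linear_combination h / 2

theorem quarticCoeff_five :
    15 * quarticCoeff μ 5 = 4 * μ * (μ ^ 2 - 1) * (μ ^ 2 - 4) := by
  have h := quarticCoeff_odd μ 1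
  have h3 := quarticCoeff_three μ
  norm_num [quarticCoeff_one] at h
  linear_combination 3 / 4 * h + (4 * μ ^ 2 - 10) / 4 * h3

/-- `∑ₖ (-1)ᵏ y₂ₖ₊₁ Xᵏ` for the coefficients `y = quarticCoeff μ`. -/
def oddQuarticSeries : K⟦X⟧ := mk fun k => (-1) ^ k * quarticCoeff μ (2 * k + 1)

theorem intCoeff_oddQuarticSeries (n : ℤ) :
    intCoeff n (oddQuarticSeries μ) = (-1) ^ n * quarticCoeff μ (2 * n + 1) := by
  rcases lt_or_ge n 0 with hn | hn
  · rw [intCoeff_of_neg hn, quarticCoeff_of_neg μ (by lia), mul_zero]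
  · lift n to ℕ using hn
    rw [intCoeff_natCast, oddQuarticSeries, coeff_mk, zpow_natCast]

theorem oddQuarticSeries_ode :
    4 * X * (1 + X) ^ 2 * d⁄dX K (d⁄dX K (oddQuarticSeries μ)) +
      6 * (1 - X ^ 2) * d⁄dX K (oddQuarticSeries μ) +
      (4 * C μ ^ 2 - 10 + 6 * X) * oddQuarticSeries μ = 0 := by
  refine ext_intCoeff fun n => ?_
  have expand (g : K⟦X⟧) : 4 * X * (1 + X) ^ 2 * d⁄dX K (d⁄dX K g) +
      6 * (1 - X ^ 2) * d⁄dX K g + (4 * C μ ^ 2 - 10 + 6 * X) * g =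
      C 4 * (X ^ 1 * d⁄dX K (d⁄dX K g)) + C 8 * (X ^ 2 * d⁄dX K (d⁄dX K g)) +
      C 4 * (X ^ 3 * d⁄dX K (d⁄dX K g)) + C 6 * d⁄dX K g - C 6 * (X ^ 2 * d⁄dX K g) +
      C (4 * μ ^ 2 - 10) * g + C 6 * (X ^ 1 * g) := by
    simp only [map_ofNat C, map_sub C, map_mul C, map_pow C]
    ring
  have hrec : 2 * (n + 1) * (2 * n + 3) * intCoeff (n + 1) (oddQuarticSeries μ) +
      (4 * μ ^ 2 + (8 * n * (n - 1) - 10)) * intCoeff n (oddQuarticSeries μ) +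
        2 * (n - 2) * (2 * n - 5) * intCoeff (n - 1) (oddQuarticSeries μ) = 0 := by
    have hne : (-1 : K) ≠ 0 := neg_ne_zero.2 one_ne_zero
    simp only [intCoeff_oddQuarticSeries, zpow_add_one₀ hne, zpow_sub_one₀ hne]
    rw [show 2 * (n + 1) + 1 = 2 * n + 3 by ring, show 2 * (n - 1) + 1 = 2 * n - 1 by ring]
    norm_num
    linear_combination -(-1) ^ n * quarticCoeff_odd μ n
  rw [expand]
  simp only [map_add (intCoeff n), map_sub (intCoeff n), intCoeff_C_mul, intCoeff_X_pow_mul,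
    intCoeff_derivative, map_zero]
  push_cast
  ring_nf at hrec ⊢
  linear_combination hrec

/-- The partial sums `∑_{k ≤ n} (-1)ᵏ y₂ₖ₊₁` for the coefficients `y = quarticCoeff μ`. -/
def quarticSum (n : ℕ) : K := ∑ k ∈ Finset.range (n + 1), (-1) ^ k * quarticCoeff μ (2 * k + 1)

theorem quarticSum_succ (n : ℕ) : quarticSum μ (n + 1) =
    quarticSum μ n + (-1) ^ (n + 1) * quarticCoeff μ (2 * (n + 1 : ℕ) + 1) :=
  Finset.sum_range_succ _ _

theorem quarticSum_zero : quarticSum μ 0 = 2 * μ := by simp [quarticSum, quarticCoeff_one]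

theorem one_sub_X_mul_mk_quarticSum : (1 - X) * mk (quarticSum μ) = oddQuarticSeries μ := by
  ext (_ | n)
  · simp [oddQuarticSeries, quarticSum]
  · rw [sub_mul, one_mul, map_sub, coeff_succ_X_mul, oddQuarticSeries, coeff_mk, coeff_mk,
      coeff_mk, quarticSum_succ, add_sub_cancel_left]

theorem radialOp_mk_quarticSum (ν : K) :
    radialOp (3 / 2) ((1 + ν) * (1 - ν)) (mk (quarticSum (2 * ν))) = 0 := by
  have hode := oddQuarticSeries_ode (2 * ν)
  rw [← one_sub_X_mul_mk_quarticSum] at hode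
  have h2 : (2 : K⟦X⟧) * C (3 / 2 : K) = 3 := by
    rw [← map_ofNat (C (R := K)) 2, ← map_mul, mul_div_cancel₀ _ (two_ne_zero' K), map_ofNat]
  have h4 : (4 : K⟦X⟧) ≠ 0 := by
    rw [← map_ofNat (C (R := K)) 4]
    simp
  refine (mul_eq_zero.1 ?_).resolve_left h4
  simp only [Derivation.leibniz, smul_eq_mul, map_sub, map_add, map_mul, map_ofNat,
    derivative_one, derivative_X, map_zero] at hode
  simp only [radialOp, map_add, map_sub, map_mul, map_one]
  linear_combination hode +
    2 * (1 + X) * (1 - 6 * X + X ^ 2) * d⁄dX K (mk (quarticSum (2 * ν))) * h2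

/-- Closed form at `c = 3/2`: with `z = sin² θ` one has
`₂F₁(1 + ν, 1 - ν; 3/2; z) = sin (2νθ) / (ν sin (2θ))`, and `ρ = tan² (θ/2)`, so that
`exp (iθ) = (1 + i√ρ) / (1 - i√ρ)`. -/
theorem fSeries_three_halves (ν : K) :
    C (4 * ν) * fSeries (1 + ν) (1 - ν) (3 / 2) = mk (quarticSum (2 * ν)) := by
  have hc (n : ℕ) : (3 / 2 : K) + n ≠ 0 := fun h => by
    have : ((3 + 2 * n : ℕ) : K) = 0 := by
      push_cast
      linear_combination 2 * h
    exact absurd (Nat.cast_eq_zero.1 this) (by lia)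
  refine eq_of_radialOp hc (m := (1 + ν) * (1 - ν)) ?_ (radialOp_mk_quarticSum ν) ?_
  · have hf := radialOp_fSeries hc (a := 1 + ν) (b := 1 - ν) (by ring)
    rw [radialOp] at hf ⊢
    simp only [Derivation.leibniz, smul_eq_mul, derivative_C, mul_zero, add_zero]
    linear_combination C (4 * ν) * hf
  · rw [map_mul, constantCoeff_fSeries, constantCoeff_C, ← coeff_zero_eq_constantCoeff_apply,
      coeff_mk, quarticSum_zero]
    ring

end ThreeHalves

section ThreeHalvesOrdered

variable {K : Type*} [Field K] [LinearOrder K] [IsStrictOrderedRing K] {μ : K}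

theorem quarticCoeff_bounds (h1 : 1 ≤ μ) (h2 : μ ≤ 2) (n : ℕ) :
    quarticCoeff μ (n + 5) ≤ 0 ∧ 3 * quarticCoeff μ (n + 6) ≤ μ * quarticCoeff μ (n + 5) ∧
      3 * quarticCoeff μ (n + 5) ≤ μ * quarticCoeff μ (n + 6) := by
  have hsq : μ ^ 2 ≤ 4 := by nlinarith
  induction n with
  | zero =>
    have h6 := quarticCoeff_add_two μ 4
    have h5 : quarticCoeff μ 5 ≤ 0 := by
      have : 0 ≤ 4 * μ * (μ ^ 2 - 1) * (4 - μ ^ 2) :=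
        mul_nonneg (mul_nonneg (by linarith) (by nlinarith)) (by linarith)
      linarith [quarticCoeff_five μ]
    norm_num at h6 ⊢
    exact ⟨h5, by linarith, by nlinarith⟩
  | succ n ih =>
    obtain ⟨hneg, hnext, hprev⟩ := ih
    have hrec := quarticCoeff_add_two μ (n + 5)
    push_cast at hrec ⊢
    rw [show (n : ℤ) + 5 + 2 = n + 7 by ring, show (n : ℤ) + 5 + 1 = n + 6 by ring] at hrec
    rw [show (n : ℤ) + 1 + 5 = n + 6 by ring, show (n : ℤ) + 1 + 6 = n + 7 by ring]
    generalize quarticCoeff μ (n + 5) = x at *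
    generalize quarticCoeff μ (n + 6) = y at *
    generalize quarticCoeff μ (n + 7) = z at *
    have hn : (0 : K) ≤ n := n.cast_nonneg
    have hn7 : (0 : K) < n + 7 := by linarith
    have hy : y ≤ 0 := by nlinarith
    refine ⟨hy, le_of_mul_le_mul_left ?_ hn7, le_of_mul_le_mul_left ?_ hn7⟩
    · nlinarith [mul_le_mul_of_nonneg_left hprev (by linarith : 0 ≤ (n : K) + 1)]
    · have hxy := mul_le_mul_of_nonneg_left hnext (by linarith : 0 ≤ (n : K) + 1)
      have hyμ := mul_le_mul_of_nonpos_right hsq hy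
      have : (n + 7) * (μ * z) = 2 * (μ ^ 2 * y) + (n + 1) * (μ * x) := by
        linear_combination μ * hrec
      nlinarith

theorem quarticCoeff_le_add_two (h1 : 1 ≤ μ) (h2 : μ ≤ 2) (n : ℕ) :
    quarticCoeff μ (n + 5) ≤ quarticCoeff μ (n + 7) := by
  obtain ⟨-, -, hprev⟩ := quarticCoeff_bounds h1 h2 n
  have hrec := quarticCoeff_add_two μ (n + 5)
  push_cast at hrec
  rw [show (n : ℤ) + 5 + 2 = n + 7 by ring, show (n : ℤ) + 5 + 1 = n + 6 by ring] at hrec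
  have hn : (0 : K) < n + 7 := by positivity
  refine le_of_mul_le_mul_left ?_ hn
  linarith

theorem quarticSum_one_nonneg (h1 : 1 ≤ μ) (h2 : μ ≤ 2) : 0 ≤ quarticSum μ 1 := by
  have h : 3 * quarticSum μ 1 = 4 * μ * (4 - μ ^ 2) := by
    have h3 := quarticCoeff_three μ
    rw [quarticSum_succ, quarticSum_zero]
    norm_num
    linear_combination -h3
  have : 0 ≤ 4 * μ * (4 - μ ^ 2) := mul_nonneg (by linarith) (by nlinarith)
  linarith

theorem quarticSum_two_nonneg (h1 : 1 ≤ μ) (h2 : μ ≤ 2) : 0 ≤ quarticSum μ 2 := by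
  have h : 15 * quarticSum μ 2 = 4 * μ * (4 - μ ^ 2) * (6 - μ ^ 2) := by
    have h3 := quarticCoeff_three μ
    have h5 := quarticCoeff_five μ
    rw [quarticSum_succ, quarticSum_succ, quarticSum_zero]
    norm_num
    linear_combination -5 * h3 + h5
  have : 0 ≤ 4 * μ * (4 - μ ^ 2) * (6 - μ ^ 2) :=
    mul_nonneg (mul_nonneg (by linarith) (by nlinarith)) (by nlinarith)
  linarith

theorem quarticSum_two_mul_add_three (μ : K) (j : ℕ) :
    quarticSum μ (2 * j + 3) = quarticSum μ (2 * j + 2) - quarticCoeff μ ((4 * j + 2 : ℕ) + 5) := by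
  rw [quarticSum_succ, Odd.neg_one_pow ⟨j + 1, by ring⟩]
  push_cast
  ring_nf

theorem quarticSum_two_mul_add_two_nonneg (h1 : 1 ≤ μ) (h2 : μ ≤ 2) (j : ℕ) :
    0 ≤ quarticSum μ (2 * j + 2) := by
  induction j with
  | zero => exact quarticSum_two_nonneg h1 h2
  | succ j ih =>
    have hpair := quarticCoeff_le_add_two h1 h2 (4 * j + 2)
    have h : quarticSum μ (2 * (j + 1) + 2) =
        quarticSum μ (2 * j + 3) + quarticCoeff μ ((4 * j + 2 : ℕ) + 7) := by
      rw [show 2 * (j + 1) + 2 = 2 * j + 3 + 1 by ring, quarticSum_succ,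
        Even.neg_one_pow ⟨j + 2, by ring⟩]
      push_cast
      ring_nf
    rw [h, quarticSum_two_mul_add_three]
    linarith

theorem quarticSum_nonneg (h1 : 1 ≤ μ) (h2 : μ ≤ 2) (n : ℕ) : 0 ≤ quarticSum μ n := by
  obtain ⟨j, rfl | rfl⟩ := n.even_or_odd'
  · rcases j with _ | j
    · rw [mul_zero, quarticSum_zero]
      linarith
    · exact quarticSum_two_mul_add_two_nonneg h1 h2 j
  · rcases j with _ | j
    · exact quarticSum_one_nonneg h1 h2
    · have h := quarticSum_two_mul_add_three μ j
      rw [show 2 * (j + 1) + 1 = 2 * j + 3 by ring, h]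
      linarith [quarticSum_two_mul_add_two_nonneg h1 h2 j,
        (quarticCoeff_bounds h1 h2 (4 * j + 2)).1]

theorem nonnegCoeffs_fSeries_three_halves {a b : K} (ha : 0 < a) (hb : 0 < b) (hab : a + b = 2) :
    NonnegCoeffs (fSeries a b (3 / 2)) := by
  wlog hba : b ≤ a generalizing a b
  · rw [fSeries_comm]
    exact this hb ha (by linarith) (le_of_not_ge hba)
  rcases le_or_gt a (3 * b + 1) with h | h
  · exact nonnegCoeffs_fSeries_of_le (d := 1) (by norm_num) (by linarith) ha.le hb.le h
      (by linarith)
  · refine .of_C_mul (r := 4 * (a - 1)) (by linarith) ?_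
    have hcl := fSeries_three_halves (a - 1)
    rw [show 1 + (a - 1) = a by ring, show 1 - (a - 1) = b by linarith] at hcl
    rw [hcl]
    intro n
    rw [coeff_mk]
    exact quarticSum_nonneg (by linarith) (by linarith) n

theorem nonnegCoeffs_fSeries [Archimedean K] {d : ℕ} {a b c : K} (hd : 2 * c = d + 2)
    (ha : 0 < a) (hb : 0 < b) (hab : a + b + 1 = 2 * c) : NonnegCoeffs (fSeries a b c) := by
  induction d using Nat.twoStepInduction generalizing a b c with
  | zero =>
    norm_num at hd
    exact nonnegCoeffs_fSeries_of_le (d := 0) (by simpa using hd) hab ha.le hb.le (by linarith)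
      (by linarith)
  | one =>
    obtain rfl : c = 3 / 2 := by
      norm_num at hd
      linarith
    exact nonnegCoeffs_fSeries_three_halves ha hb (by linarith)
  | more d ih _ =>
    push_cast at hd
    have hd' : 2 * (c - 1) = d + 2 := by linarith
    simpa only [sub_add_cancel] using nonnegCoeffs_fSeries_add_one hd'
      (fun a b ha hb hab => ih hd' ha hb hab) ha hb (by linarith)

end ThreeHalvesOrdered

section Map

theorem map_ascPochhammer_eval {R S : Type*} [Semiring R] [Semiring S] (φ : R →+* S) (x : R)
    (n : ℕ) :
    φ ((ascPochhammer R n).eval x) = (ascPochhammer S n).eval (φ x) := by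
  rw [← ascPochhammer_map φ, Polynomial.eval_map_apply]

variable {K L : Type*} [Field K] [CharZero K] [Field L] [CharZero L] (φ : K →+* L)

theorem map_binomialSeries (r : K) : map φ (binomialSeries K r) = binomialSeries L (φ r) := by
  ext n
  simp only [coeff_map, binomialSeries_coeff, smul_eq_mul, mul_one, Ring.map_choose]

theorem map_binomialProd (p q : K) :
    map φ (binomialProd p q) = binomialProd (φ p) (φ q) := by
  simp only [binomialProd, map_mul, ← rescale_map, map_binomialSeries, map_neg, map_one]

theorem map_bilinSeries (a b c : K) :
    map φ (bilinSeries a b c) = bilinSeries (φ a) (φ b) (φ c) := by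
  ext n
  simp only [coeff_map, bilinSeries, coeff_mk, map_mul, map_div₀, map_natCast, ← map_sub, ← map_neg,
    map_ascPochhammer_eval, ← map_binomialProd]

theorem map_bSeries (a b c : K) : map φ (bSeries a b c) = bSeries (φ a) (φ b) (φ c) := by
  simp only [bSeries, map_mul, map_binomialProd, map_bilinSeries, map_sub, map_one, map_ofNat]

theorem NonnegCoeffs.map {R S : Type*} [Semiring R] [Preorder R] [Semiring S] [Preorder S]
    {φ : R →+* S} (hφ : Monotone φ) {f : R⟦X⟧} (hf : NonnegCoeffs f) :
    NonnegCoeffs (map φ f) := fun n => by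
  rw [coeff_map, ← map_zero φ]
  exact hφ (hf n)

end Map

section Complex

open scoped ComplexOrder

theorem monotone_ofRealHom : Monotone Complex.ofRealHom :=
  fun _ _ h => Complex.real_le_real.2 h

theorem nonnegCoeffs_bilinSeries_star {c : ℝ} (hc : 0 ≤ c) (a : ℂ) :
    NonnegCoeffs (bilinSeries a (star a) (c : ℂ)) := fun m => by
  have hstar : binomialProd (star a - c) (-star a) =
      map (starRingEnd ℂ) (binomialProd (a - c) (-a)) := by
    rw [map_binomialProd, map_sub, map_neg, Complex.conj_ofReal]
    rfl
  have hw : (0 : ℂ) ≤ m.factorial / (ascPochhammer ℂ m).eval (c : ℂ) := by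
    have h := map_ascPochhammer_eval Complex.ofRealHom c m
    rw [Complex.ofRealHom_eq_coe, Complex.ofRealHom_eq_coe] at h
    rw [← h, ← Complex.ofReal_natCast, ← Complex.ofReal_div]
    exact Complex.zero_le_real.2 (div_nonneg m.factorial.cast_nonneg (
      ascPochhammer_eval_nonneg hc m))
  rw [bilinSeries, coeff_mk, hstar, coeff_map]
  exact mul_nonneg hw (mul_star_self_nonneg _)

theorem nonnegCoeffs_bSeries_star {d : ℕ} {c : ℝ} (hd : 2 * c = d + 2) (a : ℂ) :
    NonnegCoeffs (bSeries a (star a) (c : ℂ)) := by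
  have hd0 : (0 : ℝ) ≤ d := d.cast_nonneg
  have hprod : NonnegCoeffs (binomialProd (1 - c) (2 * c - 1)) := by
    have h := nonnegCoeffs_binomialProd (by linarith : 1 - c ≤ 0) (d + 1)
    rwa [show ((d + 1 : ℕ) : ℝ) = 2 * c - 1 by push_cast; linarith] at h
  have h := hprod.map monotone_ofRealHom
  simp only [map_binomialProd, Complex.ofRealHom_eq_coe, Complex.ofReal_sub, Complex.ofReal_mul,
    Complex.ofReal_one, Complex.ofReal_ofNat] at h
  exact h.mul (nonnegCoeffs_bilinSeries_star (by linarith) a)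

theorem nonnegCoeffs_bSeries_ofReal {d : ℕ} {a b c : ℝ} (hd : 2 * c = d + 2) (ha : 0 < a)
    (hb : 0 < b) (hab : a + b + 1 = 2 * c) : NonnegCoeffs (bSeries (a : ℂ) b c) := by
  have hc : 0 < c := by linarith
  have h := (nonnegCoeffs_fSeries hd ha hb hab).map monotone_ofRealHom
  rwa [← bSeries_eq_fSeries (add_natCast_ne_zero_of_pos hc) hab, map_bSeries] at h

end Complex

section Coefficients

theorem coeff_rescale_neg_one_binomialSeries_neg {K : Type*} [Field K] [CharZero K] (x : K)
    (n : ℕ) : coeff n (rescale (-1) (binomialSeries K (-x))) =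
      (ascPochhammer K n).eval x / n.factorial := by
  have hn : (n.factorial : K) ≠ 0 := by exact_mod_cast n.factorial_ne_zero
  rw [eq_div_iff hn, coeff_rescale, binomialSeries_coeff, smul_eq_mul, mul_one]
  have h := ascPochhammer_eval_neg_eq_descPochhammer K (-x) n
  rw [neg_neg] at h
  rw [h, ← factorial_mul_choose]
  ring

theorem aCoeff_eq_coeff_binomialProd (n : ℕ) (h δ : ℂ) :
    aCoeff n h δ = coeff n (binomialProd (-(h + δ)) (-(h - δ))) := by
  have hplus (x : ℂ) (k : ℕ) :
      coeff k (binomialSeries ℂ (-x)) = (-1) ^ k * (poch x k / k.factorial) := by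
    rw [poch, ← coeff_rescale_neg_one_binomialSeries_neg, coeff_rescale, ← mul_assoc, ← mul_pow,
      neg_one_mul, neg_neg, one_pow, one_mul]
  rw [binomialProd, mul_comm, coeff_mul, Finset.Nat.sum_antidiagonal_eq_sum_range_succ_mk, aCoeff]
  refine Finset.sum_congr rfl fun k _ => ?_
  rw [coeff_rescale_neg_one_binomialSeries_neg, hplus, poch, poch]
  ring

theorem aCoeff_mul_aCoeff (d n : ℕ) (lam : ℂ) :
    n.factorial / poch (((d : ℂ) + 1) / 2) n *
      (aCoeff n (((d : ℂ) + 1) / 4) (-(((d : ℂ) - 1) / 4) + Complex.I * lam) *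
        aCoeff n (((d : ℂ) + 1) / 4) (-(((d : ℂ) - 1) / 4) - Complex.I * lam)) =
    coeff n (bilinSeries ((d : ℂ) / 2 + Complex.I * lam) ((d : ℂ) / 2 - Complex.I * lam)
      (((d : ℂ) + 1) / 2)) := by
  rw [aCoeff_eq_coeff_binomialProd, aCoeff_eq_coeff_binomialProd, bilinSeries, coeff_mk, poch]
  ring_nf

theorem bCoeff_eq_coeff_bSeries (d n : ℕ) (lam : ℂ) : bCoeff d n lam =
    coeff n (bSeries ((d : ℂ) / 2 + Complex.I * lam) ((d : ℂ) / 2 - Complex.I * lam)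
      (((d : ℂ) + 1) / 2)) := by
  have hprod : binomialProd (1 - ((d : ℂ) + 1) / 2) (2 * (((d : ℂ) + 1) / 2) - 1) =
      ∑ l ∈ Finset.range (d + 1), C (d.choose l : ℂ) * X ^ l *
        rescale (-1) (binomialSeries ℂ (-(((d : ℂ) - 1) / 2))) := by
    rw [← Finset.sum_mul, binomialProd, mul_comm,
      show 2 * (((d : ℂ) + 1) / 2) - 1 = d by ring, binomialSeries_nat, add_comm (1 : ℂ⟦X⟧),
      add_pow]
    congr 1
    · refine Finset.sum_congr rfl fun l _ => ?_
      rw [one_pow, mul_one, mul_comm, map_natCast]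
    · ring_nf
  rw [bSeries, hprod, Finset.sum_mul, map_sum, bCoeff]
  refine Finset.sum_congr rfl fun l _ => ?_
  rw [mul_assoc, mul_assoc, coeff_C_mul, coeff_X_pow_mul']
  split_ifs with hl
  · rw [coeff_mul, Finset.Nat.sum_antidiagonal_eq_sum_range_succ_mk, Finset.mul_sum,
      Nat.sub_add_comm hl]
    refine Finset.sum_congr rfl fun k _ => ?_
    rw [← aCoeff_mul_aCoeff, coeff_rescale_neg_one_binomialSeries_neg, poch]
    ring
  · rw [Nat.sub_eq_zero_of_le (by lia), Finset.sum_range_zero, mul_zero]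

end Coefficients

section Evaluation

variable {𝕜 : Type*} [NormedField 𝕜] {f g : 𝕜⟦X⟧} {ρ : 𝕜}

/-- Absolute convergence of the power series `f` at the point `ρ`. -/
def AbsConvAt (f : 𝕜⟦X⟧) (ρ : 𝕜) : Prop := Summable fun n => ‖coeff n f * ρ ^ n‖

/-- The value at `ρ` of the power series `f`, zero if the series does not converge. -/
def evalAt (f : 𝕜⟦X⟧) (ρ : 𝕜) : 𝕜 := ∑' n, coeff n f * ρ ^ n

/-- The sum of the norms of the terms at `ρ` of the power series `f`, zero if it is infinite. -/
def absEvalAt (f : 𝕜⟦X⟧) (ρ : 𝕜) : ℝ := ∑' n, ‖coeff n f * ρ ^ n‖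

theorem absEvalAt_nonneg (f : 𝕜⟦X⟧) (ρ : 𝕜) : 0 ≤ absEvalAt f ρ :=
  tsum_nonneg fun _ => norm_nonneg _

theorem absConvAt_rescale (r : 𝕜) : AbsConvAt (rescale r f) ρ ↔ AbsConvAt f (r * ρ) := by
  simp only [AbsConvAt, coeff_rescale, mul_pow, mul_left_comm, mul_assoc]

theorem AbsConvAt.C_mul (hf : AbsConvAt f ρ) (r : 𝕜) : AbsConvAt (C r * f) ρ := by
  simpa only [AbsConvAt, coeff_C_mul, mul_assoc, norm_mul r] using Summable.mul_left ‖r‖ hf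

theorem coeff_mul_mul_pow (f g : 𝕜⟦X⟧) (ρ : 𝕜) (n : ℕ) : coeff n (f * g) * ρ ^ n =
    ∑ kl ∈ Finset.HasAntidiagonal.antidiagonal n,
      (coeff kl.1 f * ρ ^ kl.1) * (coeff kl.2 g * ρ ^ kl.2) := by
  rw [coeff_mul, Finset.sum_mul]
  refine Finset.sum_congr rfl fun kl hkl => ?_
  rw [← Finset.HasAntidiagonal.mem_antidiagonal.1 hkl, pow_add]
  ring

theorem AbsConvAt.mul (hf : AbsConvAt f ρ) (hg : AbsConvAt g ρ) : AbsConvAt (f * g) ρ := by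
  simpa only [AbsConvAt, coeff_mul_mul_pow] using
    summable_norm_sum_mul_antidiagonal_of_summable_norm hf hg

theorem absEvalAt_mul_le (hf : AbsConvAt f ρ) (hg : AbsConvAt g ρ) :
    absEvalAt (f * g) ρ ≤ absEvalAt f ρ * absEvalAt g ρ := by
  have hf' : Summable fun n => ‖‖coeff n f * ρ ^ n‖‖ := by
    simpa only [norm_norm, AbsConvAt] using hf
  have hg' : Summable fun n => ‖‖coeff n g * ρ ^ n‖‖ := by
    simpa only [norm_norm, AbsConvAt] using hg
  rw [absEvalAt, absEvalAt, absEvalAt,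
    tsum_mul_tsum_eq_tsum_sum_antidiagonal_of_summable_norm hf' hg']
  refine (hf.mul hg).tsum_le_tsum (fun n => ?_)
    (summable_norm_sum_mul_antidiagonal_of_summable_norm hf' hg').of_norm
  rw [coeff_mul_mul_pow]
  exact (norm_sum_le _ _).trans (Finset.sum_le_sum fun kl _ => (norm_mul _ _).le)

theorem coeff_one_mul_pow (ρ : 𝕜) (n : ℕ) :
    coeff n (1 : 𝕜⟦X⟧) * ρ ^ n = if n = 0 then 1 else 0 := by
  rw [coeff_one]
  split_ifs with hn <;> simp [hn]

theorem absEvalAt_one (ρ : 𝕜) : absEvalAt 1 ρ = 1 := by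
  simp only [absEvalAt, coeff_one_mul_pow]
  rw [tsum_eq_single 0 fun n hn => by simp [hn]]
  simp

theorem AbsConvAt.pow (hf : AbsConvAt f ρ) (k : ℕ) : AbsConvAt (f ^ k) ρ := by
  induction k with
  | zero =>
    simp only [AbsConvAt, pow_zero, coeff_one_mul_pow]
    exact summable_of_ne_finset_zero (s := {0}) fun n hn => by simpa using hn
  | succ k ih => rw [pow_succ]; exact ih.mul hf

theorem absEvalAt_pow_le (hf : AbsConvAt f ρ) (k : ℕ) :
    absEvalAt (f ^ k) ρ ≤ absEvalAt f ρ ^ k := by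
  induction k with
  | zero => rw [pow_zero, pow_zero, absEvalAt_one]
  | succ k ih =>
    rw [pow_succ, pow_succ]
    exact (absEvalAt_mul_le (hf.pow k) hf).trans
      (mul_le_mul_of_nonneg_right ih (absEvalAt_nonneg f ρ))

variable [CompleteSpace 𝕜]

theorem AbsConvAt.hasSum_evalAt (hf : AbsConvAt f ρ) :
    HasSum (fun n => coeff n f * ρ ^ n) (evalAt f ρ) :=
  (Summable.of_norm hf).hasSum

theorem evalAt_mul (hf : AbsConvAt f ρ) (hg : AbsConvAt g ρ) :
    evalAt (f * g) ρ = evalAt f ρ * evalAt g ρ := by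
  simp only [evalAt, coeff_mul_mul_pow]
  exact (tsum_mul_tsum_eq_tsum_sum_antidiagonal_of_summable_norm hf hg).symm

theorem evalAt_pow (hf : AbsConvAt f ρ) (k : ℕ) : evalAt (f ^ k) ρ = evalAt f ρ ^ k := by
  induction k with
  | zero =>
    simp only [evalAt, pow_zero, coeff_one_mul_pow]
    exact tsum_ite_eq 0 _
  | succ k ih => rw [pow_succ, evalAt_mul (hf.pow k) hf, ih, pow_succ]

theorem evalAt_subst (hg : HasSubst g) (hgρ : AbsConvAt g ρ)
    (hf : Summable fun k => ‖coeff k f‖ * absEvalAt g ρ ^ k) :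
    evalAt (f.subst g) ρ = evalAt f (evalAt g ρ) := by
  set F : ℕ × ℕ → 𝕜 := fun x => coeff x.1 f * (coeff x.2 (g ^ x.1) * ρ ^ x.2) with hF
  have hsum : Summable F := by
    refine Summable.of_norm ((summable_prod_of_nonneg fun _ => norm_nonneg _).2 ⟨fun k => ?_, ?_⟩)
    · simp only [hF, norm_mul (coeff k f)]
      exact (hgρ.pow k).mul_left _
    · refine hf.of_nonneg_of_le (fun k => tsum_nonneg fun _ => norm_nonneg _) fun k => ?_
      simp only [hF, norm_mul (coeff k f)]
      rw [tsum_mul_left]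
      exact mul_le_mul_of_nonneg_left (absEvalAt_pow_le hgρ k) (norm_nonneg _)
  have hcoeff (n : ℕ) : coeff n (f.subst g) * ρ ^ n = ∑' k, F (k, n) := by
    rw [coeff_subst' hg, ← tsum_eq_finsum (L := .unconditional ℕ) (coeff_subst_finite' hg _ n),
      ← tsum_mul_right]
    simp only [hF, smul_eq_mul, mul_assoc]
  calc evalAt (f.subst g) ρ = ∑' n, ∑' k, F (k, n) := tsum_congr hcoeff
    _ = ∑' k, ∑' n, F (k, n) := Summable.tsum_comm (f := fun k n => F (k, n)) hsum
    _ = ∑' k, coeff k f * evalAt (g ^ k) ρ := tsum_congr fun k => by rw [evalAt, ← tsum_mul_left]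
    _ = evalAt f (evalAt g ρ) := by simp only [evalAt_pow hgρ]; rfl

end Evaluation

section UnitDisc

variable {𝕜 : Type*} [NormedField 𝕜] {f g : 𝕜⟦X⟧} {ρ : 𝕜}

/-- Absolute convergence of the power series `f` on the open unit disc. -/
def ConvOnDisc (f : 𝕜⟦X⟧) : Prop := ∀ ⦃ρ : 𝕜⦄, ‖ρ‖ < 1 → AbsConvAt f ρ

theorem ConvOnDisc.mul (hf : ConvOnDisc f) (hg : ConvOnDisc g) : ConvOnDisc (f * g) :=
  fun _ hρ => (hf hρ).mul (hg hρ)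

theorem ConvOnDisc.C_mul (hf : ConvOnDisc f) (r : 𝕜) : ConvOnDisc (C r * f) :=
  fun _ hρ => (hf hρ).C_mul r

theorem ConvOnDisc.rescale (hf : ConvOnDisc f) {r : 𝕜} (hr : ‖r‖ = 1) :
    ConvOnDisc (rescale r f) := fun ρ hρ =>
  (absConvAt_rescale r).2 (hf (by rwa [norm_mul, hr, one_mul]))

theorem ConvOnDisc.hadamard {𝕜 : Type*} [RCLike 𝕜] {f g : 𝕜⟦X⟧} (hf : ConvOnDisc f)
    (hg : ConvOnDisc g) : ConvOnDisc (mk fun n => coeff n f * coeff n g) := fun ρ hρ => by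
  set s : 𝕜 := RCLike.ofReal √‖ρ‖
  have hs : ‖s‖ = √‖ρ‖ := by rw [RCLike.norm_ofReal, abs_of_nonneg (Real.sqrt_nonneg _)]
  have hs1 : ‖s‖ < 1 := by rwa [hs, Real.sqrt_lt' one_pos, one_pow]
  refine ((summable_mul_of_summable_norm (hf hs1) (hg hs1)).norm.comp_injective
    (i := fun n : ℕ => (n, n)) fun m n h => (Prod.ext_iff.1 h).1).congr fun n => ?_
  have hsn : ‖ρ‖ ^ n = ‖s‖ ^ n * ‖s‖ ^ n := by
    rw [← mul_pow, hs, Real.mul_self_sqrt (norm_nonneg _)]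
  simp only [Function.comp, coeff_mk, norm_mul, norm_pow, hsn]
  ring

theorem ConvOnDisc.analyticOnNhd_evalAt {𝕜 : Type*} [RCLike 𝕜] {f : 𝕜⟦X⟧} (hf : ConvOnDisc f) :
    AnalyticOnNhd 𝕜 (evalAt f) (Metric.ball 0 1) := by
  set p := FormalMultilinearSeries.ofScalars 𝕜 (fun n => coeff n f) with hp
  have hrad : 1 ≤ p.radius := by
    refine ENNReal.le_of_forall_nnreal_lt fun r hr => p.le_radius_of_summable ?_
    have hr' : ‖((r : ℝ) : 𝕜)‖ = r := by rw [RCLike.norm_ofReal, abs_of_nonneg r.coe_nonneg]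
    refine (hf (by rw [hr']; exact_mod_cast hr : ‖((r : ℝ) : 𝕜)‖ < 1)).congr fun n => ?_
    rw [hp, FormalMultilinearSeries.ofScalars_norm, norm_mul, norm_pow, hr']
  have h := ((p.hasFPowerSeriesOnBall (zero_lt_one.trans_le hrad)).mono zero_lt_one
    hrad).analyticOnNhd
  rw [← ENNReal.ofReal_one, Metric.eball_ofReal] at h
  exact h.congr Metric.isOpen_ball fun z _ => FormalMultilinearSeries.ofScalars_sum_eq _ z

theorem convOnDisc_mk_coeff {𝕜 : Type*} [NontriviallyNormedField 𝕜]
    {p : FormalMultilinearSeries 𝕜 𝕜 𝕜} (hp : 1 ≤ p.radius) : ConvOnDisc (mk p.coeff) :=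
  fun ρ hρ => by
    have hmem : ρ ∈ Metric.eball (0 : 𝕜) p.radius :=
      Metric.eball_subset_eball hp (by
        rwa [← ENNReal.ofReal_one, Metric.eball_ofReal, mem_ball_zero_iff])
    refine (p.summable_norm_apply hmem).congr fun n => ?_
    rw [FormalMultilinearSeries.apply_eq_pow_smul_coeff, coeff_mk, smul_eq_mul, mul_comm]

end UnitDisc

theorem convOnDisc_binomialSeries {𝕜 : Type*} [RCLike 𝕜] (a : 𝕜) :
    ConvOnDisc (PowerSeries.binomialSeries 𝕜 a) := by
  have hmk : PowerSeries.binomialSeries 𝕜 a = mk (_root_.binomialSeries 𝕜 a).coeff := by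
    ext n
    simp [_root_.binomialSeries, FormalMultilinearSeries.coeff_ofScalars]
  rw [hmk]
  exact convOnDisc_mk_coeff binomialSeries_radius_ge_one

theorem convOnDisc_binomialProd {𝕜 : Type*} [RCLike 𝕜] (p q : 𝕜) :
    ConvOnDisc (binomialProd p q) :=
  ((convOnDisc_binomialSeries p).rescale (by simp)).mul (convOnDisc_binomialSeries q)

section Hypergeometric

variable {a b c : ℂ}

theorem Gamma_ne_zero_of_add_natCast_ne_zero (hc : ∀ n : ℕ, c + n ≠ 0) : Complex.Gamma c ≠ 0 :=
  Complex.Gamma_ne_zero fun n h => hc n (by rw [h, neg_add_cancel])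

theorem coeff_regularizedGaussHGFunSeries_eq_div (hc : ∀ n : ℕ, c + n ≠ 0) (n : ℕ) :
    (Complex.regularizedGaussHGFunSeries a b c).coeff n =
      coeff n (gaussSeries a b c) / Complex.Gamma c := by
  have hΓ := Complex.Gamma_add_nat_div_Gamma_eq (n := n) c fun m h =>
    hc m (by rw [h, neg_add_cancel])
  rw [div_eq_iff (Gamma_ne_zero_of_add_natCast_ne_zero hc)] at hΓ
  rw [Complex.coeff_regularizedGaussHGFunSeries, gaussSeries, coeff_mk, hΓ, div_div]
  ring

theorem regularizedGaussHGFun_eq_div (hc : ∀ n : ℕ, c + n ≠ 0) (z : ℂ) :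
    Complex.regularizedGaussHGFun a b c z =
      evalAt (gaussSeries a b c) z / Complex.Gamma c := by
  rw [Complex.regularizedGaussHGFun, FormalMultilinearSeries.sum, evalAt, ← tsum_div_const]
  refine tsum_congr fun k => ?_
  rw [FormalMultilinearSeries.apply_eq_pow_smul_coeff, smul_eq_mul,
    coeff_regularizedGaussHGFunSeries_eq_div hc]
  ring

theorem convOnDisc_gaussSeries (hc : ∀ n : ℕ, c + n ≠ 0) : ConvOnDisc (gaussSeries a b c) := by
  have hmk : gaussSeries a b c =
      C (Complex.Gamma c) * mk (Complex.regularizedGaussHGFunSeries a b c).coeff := by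
    ext n
    rw [coeff_C_mul, coeff_mk, coeff_regularizedGaussHGFunSeries_eq_div hc,
      mul_div_cancel₀ _ (Gamma_ne_zero_of_add_natCast_ne_zero hc)]
  rw [hmk]
  exact (convOnDisc_mk_coeff
    (Complex.radius_regularizedGaussHGFunSeries_ge_one a b c)).C_mul (Complex.Gamma c)

-- The weight `m! / (c)ₘ` is the `m`-th coefficient of `₂F₁(1, 1; c; ·)`.
theorem convOnDisc_bilinSeries (hc : ∀ n : ℕ, c + n ≠ 0) : ConvOnDisc (bilinSeries a b c) := by
  have hmk : bilinSeries a b c = mk fun m => coeff m (gaussSeries 1 1 c) *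
      coeff m (mk fun m => coeff m (binomialProd (a - c) (-a)) *
        coeff m (binomialProd (b - c) (-b))) := by
    ext m
    have hm : (m.factorial : ℂ) ≠ 0 := mod_cast m.factorial_ne_zero
    simp only [bilinSeries, gaussSeries, coeff_mk, ascPochhammer_eval_one,
      mul_div_mul_right _ _ hm]
  rw [hmk]
  exact (convOnDisc_gaussSeries hc).hadamard
    ((convOnDisc_binomialProd _ _).hadamard (convOnDisc_binomialProd _ _))

theorem convOnDisc_bSeries (hc : ∀ n : ℕ, c + n ≠ 0) : ConvOnDisc (bSeries a b c) :=
  (convOnDisc_binomialProd _ _).mul (convOnDisc_bilinSeries hc)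

end Hypergeometric

section RadialZ

variable {ρ : ℂ}

theorem coeff_radialZ_mul_pow (ρ : ℂ) (n : ℕ) :
    coeff n (radialZ ℂ) * ρ ^ n = -4 * (n * (-ρ) ^ n) := by
  rw [radialZ, coeff_mk, neg_pow ρ]
  ring

theorem norm_coeff_radialZ_mul_pow (ρ : ℂ) (n : ℕ) :
    ‖coeff n (radialZ ℂ) * ρ ^ n‖ = 4 * (n * ‖ρ‖ ^ n) := by
  simp [coeff_radialZ_mul_pow]

theorem hasSum_norm_radialZ (hρ : ‖ρ‖ < 1) :
    HasSum (fun n => ‖coeff n (radialZ ℂ) * ρ ^ n‖) (4 * (‖ρ‖ / (1 - ‖ρ‖) ^ 2)) := by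
  simp only [norm_coeff_radialZ_mul_pow]
  exact (hasSum_coe_mul_geometric_of_norm_lt_one (r := ‖ρ‖) (by rwa [norm_norm])).mul_left 4

theorem convOnDisc_radialZ : ConvOnDisc (radialZ ℂ) := fun _ hρ => (hasSum_norm_radialZ hρ).summable

theorem absEvalAt_radialZ (hρ : ‖ρ‖ < 1) :
    absEvalAt (radialZ ℂ) ρ = 4 * (‖ρ‖ / (1 - ‖ρ‖) ^ 2) := (hasSum_norm_radialZ hρ).tsum_eq

theorem evalAt_radialZ (hρ : ‖ρ‖ < 1) : evalAt (radialZ ℂ) ρ = 4 * ρ / (1 + ρ) ^ 2 := by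
  simp only [evalAt, coeff_radialZ_mul_pow]
  rw [tsum_mul_left, tsum_coe_mul_geometric_of_norm_lt_one (by rwa [norm_neg]), sub_neg_eq_add]
  ring

theorem tendsto_absEvalAt_radialZ : Filter.Tendsto (absEvalAt (radialZ ℂ)) (𝓝 0) (𝓝 0) := by
  have hcont : ContinuousAt (fun ρ : ℂ => 4 * (‖ρ‖ / (1 - ‖ρ‖) ^ 2)) 0 := by
    fun_prop (disch := simp)
  have hlim := hcont.tendsto
  simp only [norm_zero, zero_div, mul_zero] at hlim
  refine hlim.congr' ?_
  filter_upwards [Metric.ball_mem_nhds (0 : ℂ) one_pos] with ρ hρ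
  exact (absEvalAt_radialZ (mem_ball_zero_iff.1 hρ)).symm

theorem eventually_evalAt_fSeries {a b c : ℂ} (hc : ∀ n : ℕ, c + n ≠ 0) :
    ∀ᶠ ρ in 𝓝 (0 : ℂ),
      evalAt (fSeries a b c) ρ = evalAt (gaussSeries a b c) (4 * ρ / (1 + ρ) ^ 2) := by
  filter_upwards [Metric.ball_mem_nhds (0 : ℂ) one_pos,
    tendsto_absEvalAt_radialZ.eventually_lt_const one_pos] with ρ hρ habs
  have hρ1 : ‖ρ‖ < 1 := mem_ball_zero_iff.1 hρ
  rw [← evalAt_radialZ hρ1]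
  refine evalAt_subst (hasSubst_radialZ ℂ) (convOnDisc_radialZ hρ1) ?_
  have hnorm : ‖(absEvalAt (radialZ ℂ) ρ : ℂ)‖ = absEvalAt (radialZ ℂ) ρ := by
    rw [Complex.norm_real, Real.norm_of_nonneg (absEvalAt_nonneg _ _)]
  refine (convOnDisc_gaussSeries (a := a) (b := b) hc (hnorm.trans_lt habs)).congr fun k => ?_
  rw [norm_mul, norm_pow, hnorm]

end RadialZ

section Radial

variable {u z ρ : ℂ}

/-- The Cayley transform `u ↦ (1 - u) / (1 + u)`, an involution exchanging the right half-plane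
and the unit disc. -/
def cayley (u : ℂ) : ℂ := (1 - u) / (1 + u)

theorem one_add_ne_zero_of_norm_lt_one (hρ : ‖ρ‖ < 1) : 1 + ρ ≠ 0 := fun h => by
  rw [eq_neg_of_add_eq_zero_right h, norm_neg, norm_one] at hρ
  exact lt_irrefl _ hρ

theorem one_add_ne_zero_of_re_pos (hu : 0 < u.re) : 1 + u ≠ 0 := fun h => by
  rw [eq_neg_of_add_eq_zero_right h, Complex.neg_re, Complex.one_re] at hu
  linarith

theorem cayley_cayley (hu : 1 + u ≠ 0) : cayley (cayley u) = u := by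
  simp only [cayley]
  field_simp
  ring

theorem norm_cayley_lt_one (hu : 0 < u.re) : ‖cayley u‖ < 1 := by
  rw [cayley, norm_div, div_lt_one (norm_pos_iff.2 (one_add_ne_zero_of_re_pos hu))]
  refine lt_of_pow_lt_pow_left₀ 2 (norm_nonneg _) ?_
  simp only [← Complex.normSq_eq_norm_sq, Complex.normSq_apply, Complex.sub_re, Complex.sub_im,
    Complex.add_re, Complex.add_im, Complex.one_re, Complex.one_im]
  linarith

theorem re_cayley_pos (hρ : ‖ρ‖ < 1) : 0 < (cayley ρ).re := by
  have hsq : ρ.re * ρ.re + ρ.im * ρ.im < 1 := by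
    rw [← Complex.normSq_apply, Complex.normSq_eq_norm_sq]
    exact pow_lt_one₀ (norm_nonneg _) hρ two_ne_zero
  rw [cayley, Complex.div_re, ← add_div]
  refine div_pos ?_ (Complex.normSq_pos.2 (one_add_ne_zero_of_norm_lt_one hρ))
  simp only [Complex.sub_re, Complex.sub_im, Complex.add_re, Complex.add_im, Complex.one_re,
    Complex.one_im]
  linarith

theorem four_mul_div_one_add_sq (hρ : 1 + ρ ≠ 0) : 4 * ρ / (1 + ρ) ^ 2 = 1 - cayley ρ ^ 2 := by
  rw [cayley]
  field_simp
  ring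

theorem re_cpow_half_pos (hu : u ∈ Complex.slitPlane) : 0 < (u ^ (1 / 2 : ℂ)).re := by
  have harg : u.arg < Real.pi :=
    lt_of_le_of_ne (Complex.arg_le_pi u) (Complex.mem_slitPlane_iff_arg.1 hu).1
  have him : (Complex.log u * (1 / 2)).im = u.arg / 2 := by
    rw [mul_one_div, ← Nat.cast_ofNat (R := ℂ), Complex.div_natCast_im, Complex.log_im,
      Nat.cast_ofNat]
  rw [Complex.cpow_def_of_ne_zero (Complex.slitPlane_ne_zero hu), Complex.exp_re, him]
  exact mul_pos (Real.exp_pos _)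
    (Real.cos_pos_of_mem_Ioo ⟨by linarith [Complex.neg_pi_lt_arg u], by linarith⟩)

theorem sq_mem_slitPlane (hu : 0 < u.re) : u ^ 2 ∈ Complex.slitPlane := by
  rw [Complex.mem_slitPlane_iff, sq, Complex.mul_re, Complex.mul_im]
  by_cases him : u.im = 0
  · left; rw [him, mul_zero, sub_zero]; positivity
  · right; rw [mul_comm u.im, ← two_mul]; exact mul_ne_zero two_ne_zero (mul_ne_zero hu.ne' him)

/-- The radial variable as a function of `z = (1 + σ) / 2`. -/
def radialOf (z : ℂ) : ℂ := cayley ((1 - z) ^ (1 / 2 : ℂ))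

theorem radial_eq_radialOf (σ : ℂ) : radial σ = radialOf ((1 + σ) / 2) := rfl

theorem radialOf_zero : radialOf 0 = 0 := by simp [radialOf, cayley]

theorem norm_radialOf_lt_one (hz : z ∈ cutPlane) : ‖radialOf z‖ < 1 :=
  norm_cayley_lt_one (re_cpow_half_pos hz)

theorem four_mul_radialOf (hz : z ∈ cutPlane) :
    4 * radialOf z / (1 + radialOf z) ^ 2 = z := by
  rw [four_mul_div_one_add_sq (one_add_ne_zero_of_norm_lt_one (norm_radialOf_lt_one hz)), radialOf,
    cayley_cayley (one_add_ne_zero_of_re_pos (re_cpow_half_pos hz)), one_div,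
    Complex.cpow_ofNat_inv_pow, sub_sub_cancel]

theorem radialOf_four_mul (hρ : ‖ρ‖ < 1) : radialOf (4 * ρ / (1 + ρ) ^ 2) = ρ := by
  have hne := one_add_ne_zero_of_norm_lt_one hρ
  rw [four_mul_div_one_add_sq hne, radialOf, sub_sub_cancel, one_div,
    Complex.sq_cpow_two_inv (re_cayley_pos hρ), cayley_cayley hne]

theorem four_mul_mem_cutPlane (hρ : ‖ρ‖ < 1) : 4 * ρ / (1 + ρ) ^ 2 ∈ cutPlane := by
  rw [cutPlane, Set.mem_ofPred_eq, four_mul_div_one_add_sq (one_add_ne_zero_of_norm_lt_one hρ),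
    sub_sub_cancel]
  exact sq_mem_slitPlane (re_cayley_pos hρ)

theorem analyticOnNhd_radialOf : AnalyticOnNhd ℂ radialOf cutPlane := fun z hz => by
  have hsqrt : AnalyticAt ℂ (fun z : ℂ => (1 - z) ^ (1 / 2 : ℂ)) z :=
    (analyticAt_const.sub analyticAt_id).cpow analyticAt_const hz
  exact (analyticAt_const.sub hsqrt).div (analyticAt_const.add hsqrt)
    (one_add_ne_zero_of_re_pos (re_cpow_half_pos hz))

theorem ball_subset_cutPlane : Metric.ball (0 : ℂ) 1 ⊆ cutPlane := fun z hz => by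
  refine Complex.mem_slitPlane_iff.2 (Or.inl ?_)
  rw [Complex.sub_re, Complex.one_re, sub_pos]
  exact (Complex.re_le_norm z).trans_lt (mem_ball_zero_iff.1 hz)

theorem tendsto_radialOf_zero : Filter.Tendsto radialOf (𝓝 0) (𝓝 0) := by
  have hcont : ContinuousAt radialOf 0 :=
    (analyticOnNhd_radialOf 0 (ball_subset_cutPlane (Metric.mem_ball_self one_pos))).continuousAt
  simpa only [radialOf_zero] using hcont.tendsto

end Radial

section Continuation

variable {a b c : ℂ}

theorem analyticOnNhd_evalAt_bSeries_radialOf (hc : ∀ n : ℕ, c + n ≠ 0) :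
    AnalyticOnNhd ℂ (fun z => evalAt (bSeries a b c) (radialOf z) / Complex.Gamma c) cutPlane :=
  fun z hz => AnalyticAt.div ((((convOnDisc_bSeries hc).analyticOnNhd_evalAt) (radialOf z)
      (mem_ball_zero_iff.2 (norm_radialOf_lt_one hz))).fun_comp (analyticOnNhd_radialOf z hz))
    analyticAt_const (Gamma_ne_zero_of_add_natCast_ne_zero hc)

theorem analyticOnNhd_regularizedGaussHGFun :
    AnalyticOnNhd ℂ (Complex.regularizedGaussHGFun a b c) (Metric.ball 0 1) := by
  have hrad := Complex.radius_regularizedGaussHGFunSeries_ge_one a b c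
  have h := ((FormalMultilinearSeries.hasFPowerSeriesOnBall _
    (zero_lt_one.trans_le hrad)).mono zero_lt_one hrad).analyticOnNhd
  rwa [← ENNReal.ofReal_one, Metric.eball_ofReal] at h

theorem isHypergeometricContinuation_radial (hc : ∀ n : ℕ, c + n ≠ 0) (hab : a + b + 1 = 2 * c) :
    IsHypergeometricContinuation a b c fun z =>
      evalAt (bSeries a b c) (radialOf z) / Complex.Gamma c := by
  have han := analyticOnNhd_evalAt_bSeries_radialOf (a := a) (b := b) hc
  have heq := (han.mono ball_subset_cutPlane).eqOn_of_preconnected_of_eventuallyEq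
    analyticOnNhd_regularizedGaussHGFun (convex_ball (0 : ℂ) 1).isPreconnected
    (Metric.mem_ball_self one_pos) (by
      filter_upwards [tendsto_radialOf_zero.eventually (eventually_evalAt_fSeries hc),
        Metric.ball_mem_nhds (0 : ℂ) one_pos] with z hz hz1
      rw [regularizedGaussHGFun_eq_div hc, bSeries_eq_fSeries hc hab, hz,
        four_mul_radialOf (ball_subset_cutPlane hz1)])
  exact ⟨han, fun z hz => heq (mem_ball_zero_iff.2 hz)⟩

theorem hypergeometricF_four_mul (hc : ∀ n : ℕ, c + n ≠ 0) (hab : a + b + 1 = 2 * c) {ρ : ℂ}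
    (hρ : ‖ρ‖ < 1) : hypergeometricF a b c (4 * ρ / (1 + ρ) ^ 2) =
      evalAt (bSeries a b c) ρ / Complex.Gamma c := by
  simp only [hypergeometricF_eqOn (isHypergeometricContinuation_radial hc hab)
    (four_mul_mem_cutPlane hρ), radialOf_four_mul hρ]

end Continuation

theorem half_succ_add_natCast_ne_zero (d n : ℕ) : ((d : ℂ) + 1) / 2 + n ≠ 0 := by
  rw [div_add' _ _ _ two_ne_zero]
  exact div_ne_zero (by norm_cast; omega) two_ne_zero

theorem half_one_add_sigmaOfRadial (ρ : ℂ) :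
    (1 + sigmaOfRadial ρ) / 2 = 4 * ρ / (1 + ρ) ^ 2 := by
  rw [sigmaOfRadial]
  ring

theorem hasSum_freePropagator (d : ℕ) (lam : ℂ) {ρ : ℂ} (hρ : ‖ρ‖ < 1) :
    HasSum (fun n => BCoeff d n lam * ρ ^ n) (freePropagator d lam (sigmaOfRadial ρ)) := by
  have hc := half_succ_add_natCast_ne_zero d
  rw [freePropagator, half_one_add_sigmaOfRadial, hypergeometricF_four_mul hc (by ring) hρ,
    div_mul_div_comm, ← div_mul_eq_mul_div]
  simp only [BCoeff, bCoeff_eq_coeff_bSeries, mul_assoc]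
  exact ((convOnDisc_bSeries hc hρ).hasSum_evalAt).mul_left _

section Spectrum

variable {d : ℕ} {μP μC : Measure ℝ} {lam : ℂ}

/-- The spectral parameters of the principal series, `λ ∈ ℝ`, and of the complementary series,
`λ ∈ i(-d/2, d/2)`. -/
def spectralRange (d : ℕ) : Set ℂ :=
  Set.range ((↑) : ℝ → ℂ) ∪ (fun lam : ℝ => Complex.I * (lam : ℂ)) '' complementaryRange d

/-- The principal and complementary spectral measures, assembled into one measure on the complex
plane of `λ`. -/
def spectralMeasure (d : ℕ) (μP μC : Measure ℝ) : Measure ℂ :=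
  μP.map ((↑) : ℝ → ℂ) +
    (μC.restrict (complementaryRange d)).map fun lam : ℝ => Complex.I * (lam : ℂ)

theorem measurableEmbedding_ofReal : MeasurableEmbedding ((↑) : ℝ → ℂ) :=
  Complex.isometry_ofReal.isClosedEmbedding.measurableEmbedding

theorem measurableEmbedding_I_mul_ofReal :
    MeasurableEmbedding fun lam : ℝ => Complex.I * (lam : ℂ) :=
  (measurableEmbedding_mulLeft₀ Complex.I_ne_zero).comp measurableEmbedding_ofReal

theorem spectralConverges_iff_integrable {f : ℂ → ℂ} :
    SpectralConverges d μP μC f ↔ Integrable f (spectralMeasure d μP μC) := by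
  rw [spectralMeasure, integrable_add_measure, measurableEmbedding_ofReal.integrable_map_iff,
    measurableEmbedding_I_mul_ofReal.integrable_map_iff]
  rfl

theorem SpectralConverges.spectralIntegral_eq {f : ℂ → ℂ} (hf : SpectralConverges d μP μC f) :
    spectralIntegral d μP μC f = ∫ lam, f lam ∂spectralMeasure d μP μC := by
  rw [spectralConverges_iff_integrable, spectralMeasure, integrable_add_measure] at hf
  rw [spectralMeasure, integral_add_measure hf.1 hf.2, measurableEmbedding_ofReal.integral_map,
    measurableEmbedding_I_mul_ofReal.integral_map, spectralIntegral]

theorem ae_mem_spectralRange : ∀ᵐ lam ∂spectralMeasure d μP μC, lam ∈ spectralRange d := by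
  rw [spectralMeasure, ae_add_measure_iff, measurableEmbedding_ofReal.ae_map_iff,
    measurableEmbedding_I_mul_ofReal.ae_map_iff]
  exact ⟨ae_of_all _ fun x => Or.inl ⟨x, rfl⟩,
    (ae_restrict_mem measurableSet_Ioo).mono fun x hx => Or.inr ⟨x, hx, rfl⟩⟩

theorem im_mem_complementaryRange (hd : 1 ≤ d) (hlam : lam ∈ spectralRange d) :
    lam.im ∈ complementaryRange d := by
  rcases hlam with ⟨x, rfl⟩ | ⟨x, hx, rfl⟩
  · have hd' : (0 : ℝ) < d := Nat.cast_pos.2 hd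
    rw [Complex.ofReal_im]
    exact ⟨by linarith, by linarith⟩
  · rwa [Complex.I_mul_im, Complex.ofReal_re]

end Spectrum

section Positivity

open scoped ComplexOrder

variable {d : ℕ}

theorem Gamma_mul_Gamma_star_nonneg (s : ℂ) : 0 ≤ Complex.Gamma s * Complex.Gamma (star s) :=
  (Complex.Gamma_conj s).symm ▸ mul_star_self_nonneg (Complex.Gamma s)

theorem Gamma_ofReal_nonneg {x : ℝ} (hx : 0 < x) : 0 ≤ Complex.Gamma x := by
  rw [Complex.Gamma_ofReal]
  exact Complex.zero_le_real.2 (Real.Gamma_pos_of_pos hx).le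

theorem BCoeff_nonneg_of_nonnegCoeffs {lam : ℂ}
    (hΓ : 0 ≤ Complex.Gamma ((d : ℂ) / 2 + Complex.I * lam) *
      Complex.Gamma ((d : ℂ) / 2 - Complex.I * lam))
    (hb : NonnegCoeffs (bSeries ((d : ℂ) / 2 + Complex.I * lam) ((d : ℂ) / 2 - Complex.I * lam)
      (((((d : ℝ) + 1) / 2 : ℝ)) : ℂ))) (n : ℕ) : 0 ≤ BCoeff d n lam := by
  have hc : ((d : ℂ) + 1) / 2 = ((((d : ℝ) + 1) / 2 : ℝ) : ℂ) := by push_cast; rfl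
  have hpow : (0 : ℂ) ≤ (((4 * Real.pi) ^ (((d : ℝ) + 1) / 2) : ℝ) : ℂ) :=
    Complex.zero_le_real.2 (by positivity)
  rw [BCoeff, bCoeff_eq_coeff_bSeries, hc]
  exact mul_nonneg (div_nonneg hΓ (mul_nonneg hpow (Gamma_ofReal_nonneg (by positivity)))) (hb n)

theorem BCoeff_ofReal_nonneg (hd : 1 ≤ d) (n : ℕ) (lam : ℝ) : 0 ≤ BCoeff d n lam := by
  obtain ⟨d, rfl⟩ := Nat.exists_eq_add_of_le' hd
  have hstar : ((d + 1 : ℕ) : ℂ) / 2 - Complex.I * lam =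
      star (((d + 1 : ℕ) : ℂ) / 2 + Complex.I * lam) := by
    simp [sub_eq_add_neg]
  refine BCoeff_nonneg_of_nonnegCoeffs ?_ ?_ n <;> rw [hstar]
  · exact Gamma_mul_Gamma_star_nonneg _
  · exact nonnegCoeffs_bSeries_star (d := d) (by push_cast; ring) _

theorem BCoeff_I_mul_nonneg (n : ℕ) {lam : ℝ} (hlam : lam ∈ complementaryRange d) :
    0 ≤ BCoeff d n (Complex.I * lam) := by
  obtain ⟨hl, hr⟩ := hlam
  obtain ⟨d, rfl⟩ := Nat.exists_eq_add_of_le' (Nat.cast_pos.1 (by linarith : (0 : ℝ) < d))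
  set c : ℝ := ((d + 1 : ℕ) : ℝ) / 2
  have hp : ((d + 1 : ℕ) : ℂ) / 2 + Complex.I * (Complex.I * lam) = ((c - lam : ℝ) : ℂ) := by
    rw [← mul_assoc, Complex.I_mul_I]; push_cast [c]; ring
  have hm : ((d + 1 : ℕ) : ℂ) / 2 - Complex.I * (Complex.I * lam) = ((c + lam : ℝ) : ℂ) := by
    rw [← mul_assoc, Complex.I_mul_I]; push_cast [c]; ring
  refine BCoeff_nonneg_of_nonnegCoeffs ?_ ?_ n <;> rw [hp, hm]
  · exact mul_nonneg (Gamma_ofReal_nonneg (by linarith)) (Gamma_ofReal_nonneg (by linarith))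
  · exact nonnegCoeffs_bSeries_ofReal (d := d) (by push_cast; ring) (by linarith) (by linarith)
      (by simp only [c]; ring)

theorem BCoeff_nonneg (hd : 1 ≤ d) (n : ℕ) {lam : ℂ} (hlam : lam ∈ spectralRange d) :
    0 ≤ BCoeff d n lam := by
  rcases hlam with ⟨x, rfl⟩ | ⟨x, hx, rfl⟩
  exacts [BCoeff_ofReal_nonneg hd n x, BCoeff_I_mul_nonneg n hx]

end Positivity

section Continuity

theorem continuous_poch (n : ℕ) : Continuous fun x : ℂ => poch x n :=
  (ascPochhammer ℂ n).continuous

theorem continuous_aCoeff (n : ℕ) (h : ℂ) : Continuous (aCoeff n h) := by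
  have hpoch := continuous_poch
  unfold aCoeff
  fun_prop

theorem continuous_bCoeff (d n : ℕ) : Continuous (bCoeff d n) := by
  have ha := continuous_aCoeff
  unfold bCoeff
  fun_prop

theorem continuousAt_Gamma_of_re_pos {s : ℂ} (hs : 0 < s.re) : ContinuousAt Complex.Gamma s := by
  refine Complex.continuousAt_Gamma s fun m h => ?_
  rw [h, Complex.neg_re, Complex.natCast_re] at hs
  linarith [m.cast_nonneg (α := ℝ)]

theorem continuousAt_BCoeff {d : ℕ} (n : ℕ) {lam : ℂ} (hlam : lam.im ∈ complementaryRange d) :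
    ContinuousAt (BCoeff d n) lam := by
  obtain ⟨hl, hr⟩ := hlam
  have hre : ((d : ℂ) / 2).re = (d : ℝ) / 2 := by simp
  have hplus : ContinuousAt Complex.Gamma ((d : ℂ) / 2 + Complex.I * lam) :=
    continuousAt_Gamma_of_re_pos (by rw [Complex.add_re, hre, Complex.I_mul_re]; linarith)
  have hminus : ContinuousAt Complex.Gamma ((d : ℂ) / 2 - Complex.I * lam) :=
    continuousAt_Gamma_of_re_pos (by rw [Complex.sub_re, hre, Complex.I_mul_re]; linarith)
  exact ((((hplus.comp (f := fun lam => (d : ℂ) / 2 + Complex.I * lam) (by fun_prop)).mul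
    (hminus.comp (f := fun lam => (d : ℂ) / 2 - Complex.I * lam) (by fun_prop))).div_const _).mul
    (continuous_bCoeff d n).continuousAt)

theorem aestronglyMeasurable_BCoeff {d : ℕ} (hd : 1 ≤ d) (μP μC : Measure ℝ) (n : ℕ) :
    AEStronglyMeasurable (BCoeff d n) (spectralMeasure d μP μC) := by
  rw [← Measure.restrict_eq_self_of_ae_mem
    (ae_mem_spectralRange.mono fun lam => im_mem_complementaryRange hd)]
  exact ContinuousOn.aestronglyMeasurable
    (fun lam hlam => (continuousAt_BCoeff n hlam).continuousWithinAt)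
    (Complex.measurable_im measurableSet_Ioo)

end Continuity

section Integration

open scoped ComplexOrder

variable {α : Type*} [MeasurableSpace α] {μ : Measure α} {B : ℕ → α → ℂ} {f g : α → ℂ}

theorem hasSum_norm_of_nonneg {b : ℕ → ℂ} (hb : ∀ n, 0 ≤ b n) {r : ℝ} (hr : 0 ≤ r) {s : ℂ}
    (hs : HasSum (fun n => b n * (r : ℂ) ^ n) s) : HasSum (fun n => ‖b n‖ * r ^ n) ‖s‖ := by
  have hterm (n : ℕ) : b n * (r : ℂ) ^ n = ((‖b n‖ * r ^ n : ℝ) : ℂ) := by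
    push_cast
    rw [← Complex.eq_coe_norm_of_nonneg (hb n)]
  have hs0 : 0 ≤ s := hs.nonneg fun n => mul_nonneg (hb n)
    (pow_nonneg (Complex.zero_le_real.2 hr) n)
  simp only [hterm] at hs
  rw [Complex.eq_coe_norm_of_nonneg hs0] at hs
  exact Complex.hasSum_ofReal.1 hs

theorem integrable_of_hasSum_nonneg {r : ℝ} (hr : 0 < r)
    (hmeas : ∀ n, AEStronglyMeasurable (B n) μ) (hB : ∀ᵐ x ∂μ, ∀ n, 0 ≤ B n x)
    (hg : ∀ᵐ x ∂μ, HasSum (fun n => B n x * (r : ℂ) ^ n) (g x)) (hgi : Integrable g μ) (n : ℕ) :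
    Integrable (B n) μ := by
  refine (hgi.norm.const_mul (r ^ n)⁻¹).mono (hmeas n) ?_
  filter_upwards [hB, hg] with x hx hgx
  rw [Real.norm_of_nonneg (by positivity), ← div_eq_inv_mul, le_div_iff₀ (by positivity)]
  exact le_hasSum (hasSum_norm_of_nonneg hx hr.le hgx) n fun m _ => by positivity

theorem integrable_of_hasSum_mul_pow {ρ : ℂ}
    (hmeas : ∀ n, AEStronglyMeasurable (B n) μ) (hB : ∀ᵐ x ∂μ, ∀ n, 0 ≤ B n x)
    (hf : ∀ᵐ x ∂μ, HasSum (fun n => B n x * ρ ^ n) (f x))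
    (hg : ∀ᵐ x ∂μ, HasSum (fun n => B n x * (‖ρ‖ : ℂ) ^ n) (g x)) (hgi : Integrable g μ) :
    Integrable f μ := by
  refine hgi.mono (aestronglyMeasurable_of_tendsto_ae Filter.atTop
    (f := fun N x => ∑ n ∈ Finset.range N, B n x * ρ ^ n)
    (fun N => Finset.aestronglyMeasurable_fun_sum _ fun n _ => (hmeas n).mul_const _)
    (hf.mono fun x hx => hx.tendsto_sum_nat)) ?_
  filter_upwards [hB, hf, hg] with x hx hfx hgx
  refine hfx.norm_le_of_bounded (hasSum_norm_of_nonneg hx (norm_nonneg ρ) hgx) fun n => ?_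
  rw [norm_mul, norm_pow]

-- The value of the series at `‖ρ‖` dominates it at `ρ`, because the coefficients are nonnegative.
theorem hasSum_integral_mul_pow {ρ : ℂ}
    (hmeas : ∀ n, AEStronglyMeasurable (B n) μ) (hB : ∀ᵐ x ∂μ, ∀ n, 0 ≤ B n x)
    (hf : ∀ᵐ x ∂μ, HasSum (fun n => B n x * ρ ^ n) (f x))
    (hg : ∀ᵐ x ∂μ, HasSum (fun n => B n x * (‖ρ‖ : ℂ) ^ n) (g x)) (hgi : Integrable g μ) :
    HasSum (fun n => (∫ x, B n x ∂μ) * ρ ^ n) (∫ x, f x ∂μ) := by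
  have hbound : ∀ᵐ x ∂μ, HasSum (fun n => ‖B n x‖ * ‖ρ‖ ^ n) ‖g x‖ := by
    filter_upwards [hB, hg] with x hx hgx using hasSum_norm_of_nonneg hx (norm_nonneg ρ) hgx
  simp only [← integral_mul_const]
  refine hasSum_integral_of_dominated_convergence (fun n x => ‖B n x‖ * ‖ρ‖ ^ n)
    (fun n => (hmeas n).mul_const _) (fun n => ae_of_all _ fun x => ?_)
    (hbound.mono fun x hx => hx.summable) ?_ hf
  · rw [norm_mul, norm_pow]
  · exact hgi.norm.congr (hbound.mono fun x hx => hx.tsum_eq.symm)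

end Integration

section SpectralIntegrals

open scoped ComplexOrder

variable {d : ℕ} {μP μC : Measure ℝ}

theorem ae_BCoeff_nonneg (hd : 1 ≤ d) (μP μC : Measure ℝ) :
    ∀ᵐ lam ∂spectralMeasure d μP μC, ∀ n, 0 ≤ BCoeff d n lam :=
  ae_mem_spectralRange.mono fun _ hlam n => BCoeff_nonneg hd n hlam

theorem spectralConverges_BCoeff (hd : 1 ≤ d) {r : ℝ} (hr0 : 0 < r) (hr1 : r < 1)
    (hr : SpectralConverges d μP μC fun lam => freePropagator d lam (sigmaOfRadial r)) (n : ℕ) :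
    SpectralConverges d μP μC (BCoeff d n) := by
  rw [spectralConverges_iff_integrable] at hr ⊢
  have hr1' : ‖(r : ℂ)‖ < 1 := by rwa [Complex.norm_real, Real.norm_of_nonneg hr0.le]
  exact integrable_of_hasSum_nonneg hr0 (aestronglyMeasurable_BCoeff hd μP μC)
    (ae_BCoeff_nonneg hd μP μC) (ae_of_all _ fun lam => hasSum_freePropagator d lam hr1') hr n

theorem spectralIntegral_BCoeff_nonneg (hd : 1 ≤ d) (μP μC : Measure ℝ) (n : ℕ) :
    0 ≤ spectralIntegral d μP μC (BCoeff d n) :=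
  add_nonneg (integral_nonneg (BCoeff_ofReal_nonneg hd n))
    (integral_nonneg_of_ae ((ae_restrict_mem measurableSet_Ioo).mono fun _ hlam =>
      BCoeff_I_mul_nonneg n hlam))

theorem spectralConverges_freePropagator (hd : 1 ≤ d) {ρ : ℂ} (hρ : ‖ρ‖ < 1)
    (habs : SpectralConverges d μP μC fun lam => freePropagator d lam (sigmaOfRadial ‖ρ‖)) :
    SpectralConverges d μP μC fun lam => freePropagator d lam (sigmaOfRadial ρ) := by
  rw [spectralConverges_iff_integrable] at habs ⊢
  have hρ' : ‖(‖ρ‖ : ℂ)‖ < 1 := by rwa [Complex.norm_real, norm_norm]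
  exact integrable_of_hasSum_mul_pow (aestronglyMeasurable_BCoeff hd μP μC)
    (ae_BCoeff_nonneg hd μP μC) (ae_of_all _ fun lam => hasSum_freePropagator d lam hρ)
    (ae_of_all _ fun lam => hasSum_freePropagator d lam hρ') habs

theorem hasSum_spectralIntegral (hd : 1 ≤ d) {ρ : ℂ} (hρ : ‖ρ‖ < 1)
    (hconv : ∀ r : ℝ, 0 ≤ r → r < 1 →
      SpectralConverges d μP μC fun lam => freePropagator d lam (sigmaOfRadial r)) :
    HasSum (fun n => spectralIntegral d μP μC (BCoeff d n) * ρ ^ n)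
      (spectralIntegral d μP μC fun lam => freePropagator d lam (sigmaOfRadial ρ)) := by
  have habs := hconv ‖ρ‖ (norm_nonneg ρ) hρ
  have hB := spectralConverges_BCoeff hd one_half_pos one_half_lt_one
    (hconv (1 / 2) one_half_pos.le one_half_lt_one)
  have hρ' : ‖(‖ρ‖ : ℂ)‖ < 1 := by rwa [Complex.norm_real, norm_norm]
  simp only [(hB _).spectralIntegral_eq,
    (spectralConverges_freePropagator hd hρ habs).spectralIntegral_eq]
  exact hasSum_integral_mul_pow (aestronglyMeasurable_BCoeff hd μP μC)
    (ae_BCoeff_nonneg hd μP μC) (ae_of_all _ fun lam => hasSum_freePropagator d lam hρ)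
    (ae_of_all _ fun lam => hasSum_freePropagator d lam hρ')
    (spectralConverges_iff_integrable.1 habs)

end SpectralIntegrals

section SpherePoints

variable {d : ℕ}

theorem sphereSigma_lt_one {Y₁ Y₂ : Sphere d} (h : Y₁ ≠ Y₂) : sphereSigma Y₁ Y₂ < 1 :=
  (inner_lt_one_iff_real_of_norm_eq_one (norm_eq_of_mem_sphere Y₁) (norm_eq_of_mem_sphere Y₂)).2
    fun h' => h (Subtype.ext h')

theorem sphereSigma_self (Y : Sphere d) : sphereSigma Y Y = 1 := by
  rw [sphereSigma, real_inner_self_eq_norm_sq, norm_eq_of_mem_sphere, one_pow]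

theorem sphereSigma_neg_self (Y : Sphere d) : sphereSigma Y (-Y) = -1 :=
  (inner_neg_right _ _).trans (congrArg Neg.neg (sphereSigma_self Y))

theorem exists_sphereSigma_eq (d : ℕ) {s : ℝ} (hs : s ∈ Set.Icc (-1) 1) :
    ∃ Y₁ Y₂ : Sphere d, sphereSigma Y₁ Y₂ = s := by
  have hrank : 1 < Module.rank ℝ (EuclideanSpace ℝ (Fin (d + 2))) := by
    rw [← Module.finrank_eq_rank, finrank_euclideanSpace_fin]
    exact_mod_cast Nat.lt_add_left d one_lt_two
  have : PreconnectedSpace (Sphere d) :=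
    isPreconnected_iff_preconnectedSpace.1 (isPreconnected_sphere hrank 0 1)
  let Y : Sphere d := ⟨EuclideanSpace.single 0 1, by simp⟩
  have hcont : Continuous (sphereSigma Y) := continuous_const.inner continuous_subtype_val
  obtain ⟨Y', hY'⟩ := mem_range_of_exists_le_of_exists_ge hcont
    ⟨-Y, (sphereSigma_neg_self Y).trans_le hs.1⟩ ⟨Y, hs.2.trans_eq (sphereSigma_self Y).symm⟩
  exact ⟨Y, Y', hY'⟩

theorem half_one_add_mem_cutPlane {s : ℝ} (hs : s < 1) : (1 + (s : ℂ)) / 2 ∈ cutPlane := by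
  refine Complex.mem_slitPlane_iff.2 (Or.inl ?_)
  have hre : (1 - (1 + (s : ℂ)) / 2).re = 1 - (1 + s) / 2 := by simp
  linarith

theorem sigmaOfRadial_radial {s : ℝ} (hs : s < 1) : sigmaOfRadial (radial s) = s := by
  have h := four_mul_radialOf (half_one_add_mem_cutPlane hs)
  rw [← radial_eq_radialOf, ← half_one_add_sigmaOfRadial] at h
  linear_combination 2 * h

theorem norm_radial_lt_one {s : ℝ} (hs : s < 1) : ‖radial s‖ < 1 :=
  norm_radialOf_lt_one (half_one_add_mem_cutPlane hs)

theorem HasKallenLehmann.spectralConverges {μP μC : Measure ℝ} {G : Sphere d → Sphere d → ℂ}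
    (hG : HasKallenLehmann d μP μC G) {r : ℝ} (hr0 : 0 ≤ r) (hr1 : r < 1) :
    SpectralConverges d μP μC fun lam => freePropagator d lam (sigmaOfRadial r) := by
  have hlt : 8 * r / (1 + r) ^ 2 < 2 := by
    rw [div_lt_iff₀ (by positivity)]
    nlinarith [pow_pos (sub_pos.2 hr1) 2]
  have hnn : 0 ≤ 8 * r / (1 + r) ^ 2 := by positivity
  obtain ⟨Y₁, Y₂, hs⟩ := exists_sphereSigma_eq d (s := 8 * r / (1 + r) ^ 2 - 1)
    ⟨by linarith, by linarith⟩
  have hne : Y₁ ≠ Y₂ := fun h => by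
    rw [h, sphereSigma_self] at hs
    linarith
  have hσ : (sphereSigma Y₁ Y₂ : ℂ) = sigmaOfRadial r := by
    rw [hs, sigmaOfRadial]
    push_cast
    rfl
  simpa only [hσ] using (hG Y₁ Y₂ hne).1

end SpherePoints

end DeSitter

end

theorem corollary1 (d : ℕ) (hd : 1 ≤ d) (μP μC : MeasureTheory.Measure ℝ)
    (G : DeSitter.Sphere d → DeSitter.Sphere d → ℂ)
    (hG : DeSitter.HasKallenLehmann d μP μC G) :
    ∃ c : ℕ → ℝ,
      (∀ n, 0 ≤ c n) ∧
      -- the coefficients are convergent spectral integrals of `Bₙ(d, λ)`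
      (∀ n, DeSitter.SpectralConverges d μP μC (DeSitter.BCoeff d n) ∧
        (c n : ℂ) = DeSitter.spectralIntegral d μP μC (DeSitter.BCoeff d n)) ∧
      -- the expansion of the two-point function on the sphere
      (∀ Y₁ Y₂ : DeSitter.Sphere d, Y₁ ≠ Y₂ →
        ‖DeSitter.radial (DeSitter.sphereSigma Y₁ Y₂ : ℂ)‖ < 1 ∧
        HasSum (fun n => (c n : ℂ) * DeSitter.radial (DeSitter.sphereSigma Y₁ Y₂ : ℂ) ^ n)
          (G Y₁ Y₂)) ∧
      -- on the whole open unit disc the series converges absolutely, the Källén–Lehmann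
      -- representation converges, and they agree
      (∀ ρ : ℂ, ‖ρ‖ < 1 →
        DeSitter.SpectralConverges d μP μC
          (fun lam => DeSitter.freePropagator d lam (DeSitter.sigmaOfRadial ρ)) ∧
        HasSum (fun n => (c n : ℂ) * ρ ^ n)
          (DeSitter.spectralIntegral d μP μC
            (fun lam => DeSitter.freePropagator d lam (DeSitter.sigmaOfRadial ρ)))) := by
  open DeSitter in
  have hconv (r : ℝ) (hr0 : 0 ≤ r) (hr1 : r < 1) := hG.spectralConverges hr0 hr1
  have hc (n : ℕ) : ((‖spectralIntegral d μP μC (BCoeff d n)‖ : ℝ) : ℂ) =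
      spectralIntegral d μP μC (BCoeff d n) :=
    (Complex.eq_coe_norm_of_nonneg (spectralIntegral_BCoeff_nonneg hd μP μC n)).symm
  have hdisc (ρ : ℂ) (hρ : ‖ρ‖ < 1) :
      HasSum (fun n => ((‖spectralIntegral d μP μC (BCoeff d n)‖ : ℝ) : ℂ) * ρ ^ n)
        (spectralIntegral d μP μC fun lam => freePropagator d lam (sigmaOfRadial ρ)) := by
    simpa only [hc] using hasSum_spectralIntegral hd hρ hconv
  refine ⟨fun n => ‖spectralIntegral d μP μC (BCoeff d n)‖, fun n => norm_nonneg _,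
    fun n => ⟨?_, hc n⟩, fun Y₁ Y₂ hne => ?_, fun ρ hρ => ⟨?_, hdisc ρ hρ⟩⟩
  · exact spectralConverges_BCoeff hd one_half_pos one_half_lt_one
      (hconv (1 / 2) one_half_pos.le one_half_lt_one) n
  · have hσ := sphereSigma_lt_one hne
    have hsum := hdisc _ (norm_radial_lt_one hσ)
    rw [sigmaOfRadial_radial hσ, ← (hG Y₁ Y₂ hne).2] at hsum
    exact ⟨norm_radial_lt_one hσ, hsum⟩
  · exact spectralConverges_freePropagator hd hρ (hconv ‖ρ‖ (norm_nonneg ρ) hρ)
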